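/- Let $n,p\ge 0$ be integers, let $M\in\mathbb{R}^{n\times p}$, and let $X\in\mathbb{R}^{n\times p}$ have independent entries $X_{ai}\sim \mathrm{N}(M_{ai},1)$; write $\mathrm{E}_M$ for the (entrywise) expectation. For every $X$ let $X^{\top}X=V\Lambda V^{\top}$ be a spectral decomposition, with $V=V(X)$ orthogonal and $\Lambda=\mathrm{diag}(\lambda_1,\dots,\lambda_p)$, $\lambda_1\ge\dots\ge\lambda_p\ge 0$. Let $h:\mathbb{R}^{n\times p}\to\mathbb{R}$ be orthogonally invariant, i.e. $h(PXQ)=h(X)$ for all $P\in O(n)$ and $Q\in O(p)$, written as $h(X)=H(\lambda)$ with $H:\mathbb{R}^p\to\mathbb{R}$ (not necessarily symmetric), and let $(\widetilde\nabla h(X))_{ai}=\partial h(X)/\partial X_{ai}$ be its matrix gradient. Assume that $H$ is $C^2$ in a neighbourhood of $\lambda(X)$ for Lebesgue-almost every $X$, and that all entries of $\widetilde\nabla h$ are weakly differentiable (locally integrable, with locally integrable first-order weak partial derivatives). Let $D$ be the $p\times p$ diagonal matrix with $$D_{kk} = 4 \left( 2 \lambda_k \frac{\partial^2 H}{\partial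 \lambda_k^2} + n \frac{\partial H}{\partial \lambda_k} + \lambda_k \left( \frac{\partial H}{\partial \lambda_k} \right)^2 + \sum_{l \neq k} \frac{\lambda_l}{\lambda_k-\lambda_l} \left( \frac{\partial H}{\partial \lambda_k} - \frac{\partial H}{\partial \lambda_l} \right) \right),$$ the derivatives of $H$ being taken at $\lambda=\lambda(X)$, where a summand with $\lambda_k=\lambda_l$ is read as $0$ (almost surely this happens only for pairs of zero eigenvalues, and not at all if $n\ge p-1$). If the entries of $\widetilde\nabla h(X)$ have finite second moments and the entries of $VDV^{\top}$ are integrable under $\mathrm{E}_M$, then the matrix quadratic risk of the estimator $\hat M=X+\widetilde\nabla h(X)$ is finite and $$\mathrm{E}_M\big[(\hat M-M)^{\top}(\hat M-M)\big] = n I_p + \mathrm{E}_M\big[V D V^{\top}\big].$$ -/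

import Mathlib

open Matrix MeasureTheory ProbabilityTheory
open scoped ContDiff

attribute [local instance] Matrix.normedAddCommGroup Matrix.normedSpace

namespace MatrixRisk

noncomputable section

/-- The product (equivalently Borel) sigma-algebra on real `n × p` matrices. -/
instance instMeasurableSpaceMatrix {n p : ℕ} : MeasurableSpace (Matrix (Fin n) (Fin p) ℝ) :=
  inferInstanceAs (MeasurableSpace (Fin n → Fin p → ℝ))

/-- The law of a random `n × p` matrix with independent entries `X a i ~ N(M a i, 1)`. -/
def gaussianMatrix {n p : ℕ} (M : Matrix (Fin n) (Fin p) ℝ) :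
    Measure (Matrix (Fin n) (Fin p) ℝ) :=
  Measure.pi fun a => Measure.pi fun i => gaussianReal (M a i) 1

/-- Lebesgue measure on the space of real `n × p` matrices. -/
def lebesgueMatrix (n p : ℕ) : Measure (Matrix (Fin n) (Fin p) ℝ) :=
  Measure.pi fun _ => Measure.pi fun _ => (volume : Measure ℝ)

/-- The partial derivative of `f` with respect to the entry `(a, i)`, at `X`. -/
def matrixPartial {n p : ℕ} (f : Matrix (Fin n) (Fin p) ℝ → ℝ) (a : Fin n) (i : Fin p)
    (X : Matrix (Fin n) (Fin p) ℝ) : ℝ :=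
  lineDeriv ℝ f X (Matrix.single a i (1 : ℝ))

/-- The matrix gradient of `f`, the matrix of its partial derivatives. -/
def matrixGrad {n p : ℕ} (f : Matrix (Fin n) (Fin p) ℝ → ℝ)
    (X : Matrix (Fin n) (Fin p) ℝ) : Matrix (Fin n) (Fin p) ℝ :=
  Matrix.of fun a i => matrixPartial f a i X

/-- Infinitely differentiable functions with compact support. -/
def IsTestFunction {n p : ℕ} (φ : Matrix (Fin n) (Fin p) ℝ → ℝ) : Prop :=
  ContDiff ℝ ∞ φ ∧ HasCompactSupport φ

/-- `w` is a weak partial derivative of `u` with respect to the entry `(a, i)`. -/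
def HasWeakPartial {n p : ℕ} (u w : Matrix (Fin n) (Fin p) ℝ → ℝ)
    (a : Fin n) (i : Fin p) : Prop :=
  LocallyIntegrable w (lebesgueMatrix n p) ∧
    ∀ φ : Matrix (Fin n) (Fin p) ℝ → ℝ, IsTestFunction φ →
      ∫ X, u X * matrixPartial φ a i X ∂(lebesgueMatrix n p) =
        -∫ X, w X * φ X ∂(lebesgueMatrix n p)

/-- `u` is locally integrable and has locally integrable weak partial derivatives
of first order. -/
def WeaklyDifferentiable {n p : ℕ} (u : Matrix (Fin n) (Fin p) ℝ → ℝ) : Prop :=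
  LocallyIntegrable u (lebesgueMatrix n p) ∧
    ∀ (a : Fin n) (i : Fin p), ∃ w, HasWeakPartial u w a i

/-- `h (P X Q) = h X` for all orthogonal matrices `P` and `Q`. -/
def OrthogonallyInvariant {n p : ℕ} (h : Matrix (Fin n) (Fin p) ℝ → ℝ) : Prop :=
  ∀ P ∈ Matrix.orthogonalGroup (Fin n) ℝ, ∀ Q ∈ Matrix.orthogonalGroup (Fin p) ℝ,
    ∀ X, h (P * X * Q) = h X

/-- `A = V diag(lam) Vᵀ` with `V` orthogonal and `lam 0 ≥ lam 1 ≥ …`. -/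
structure IsSpectralDecomposition {p : ℕ} (A V : Matrix (Fin p) (Fin p) ℝ)
    (lam : Fin p → ℝ) : Prop where
  orthogonal : V ∈ Matrix.orthogonalGroup (Fin p) ℝ
  antitone : Antitone lam
  eq : A = V * Matrix.diagonal lam * Vᵀ

/-- The partial derivative of `H` with respect to the `k`-th variable, at `x`. -/
def partialDeriv {p : ℕ} (H : (Fin p → ℝ) → ℝ) (k : Fin p) (x : Fin p → ℝ) : ℝ :=
  lineDeriv ℝ H x (Pi.single k 1)

/-- The diagonal entry `D k k`, at the eigenvalues `x`. -/
def riskDiag {p : ℕ} (n : ℕ) (H : (Fin p → ℝ) → ℝ) (x : Fin p → ℝ) (k : Fin p) : ℝ :=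
  4 * (2 * x k * partialDeriv (partialDeriv H k) k x + n * partialDeriv H k x
    + x k * partialDeriv H k x ^ 2
    + ∑ l ∈ Finset.univ.erase k,
        x l / (x k - x l) * (partialDeriv H k x - partialDeriv H l x))

/-- The estimator `X + ∇h(X)`. -/
def pseudoBayes {n p : ℕ} (h : Matrix (Fin n) (Fin p) ℝ → ℝ)
    (X : Matrix (Fin n) (Fin p) ℝ) : Matrix (Fin n) (Fin p) ℝ :=
  X + matrixGrad h X

/-- The matrix quadratic loss. -/
def matrixLoss {n p : ℕ} (M N : Matrix (Fin n) (Fin p) ℝ) : Matrix (Fin p) (Fin p) ℝ :=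
  (N - M)ᵀ * (N - M)

/-- Every entry of the random matrix `F` is integrable. -/
def EntrywiseIntegrable {n p : ℕ} (F : Matrix (Fin n) (Fin p) ℝ → Matrix (Fin p) (Fin p) ℝ)
    (P : Measure (Matrix (Fin n) (Fin p) ℝ)) : Prop :=
  ∀ i j, Integrable (fun X => F X i j) P

/-- The entrywise expectation of the random matrix `F`. -/
def matrixExpectation {n p : ℕ} (P : Measure (Matrix (Fin n) (Fin p) ℝ))
    (F : Matrix (Fin n) (Fin p) ℝ → Matrix (Fin p) (Fin p) ℝ) : Matrix (Fin p) (Fin p) ℝ :=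
  Matrix.of fun i j => ∫ X, F X i j ∂P

end

end MatrixRisk

/-!
Write `g = ∇h` for the matrix gradient. Expanding the loss of `X + g` leaves three kinds of terms:
the Gaussian covariance, which gives `n I`, the Gram matrix `gᵀ g`, and the cross terms
`(X - M)ᵀ g` and their transposes. By Stein's identity the `(i, j)` cross term has the expectation
of the divergence `∑ a, ∂g a j / ∂X a i`, so everything rests on the pointwise identity
`hessian_add_gram_eq`: for almost every `X`,
`2 ∑ a, ∂² h / ∂X a i ∂X a j + (gᵀ g) i j = (V D Vᵀ) i j`.

*Stein's identity.* The individual derivatives of `g` are not assumed integrable. The pointwise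
identity shows that the divergence is, since `V D Vᵀ` is integrable and `g` is square integrable.
This is enough (`integral_gaussianMatrix_stein`): test the definition of the weak derivative with
the Gaussian density times a cutoff, sum over `a`, and let the cutoff tend to one.

*Weak derivatives are classical ones.* For almost every `X` the first `min n p` eigenvalues of
`Xᵀ X` are positive and distinct, and the others vanish: this is the nonvanishing of the
Hankel determinant of the traces of powers of `Xᵀ X`, a homogeneous polynomial in `X`
(`gramHankel_ne_zero_iff`, `ae_gramHankel_ne_zero`). At such `X` the sorted eigenvalues are smooth
by the implicit function theorem (`contDiffAt_spectrum`), so `h` is `C²` on an open set of full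
measure, where the weak derivatives of `g` are the entries of its Hessian (`ae_eq_fderiv_of_weak`).

*The pointwise identity.* By a singular value decomposition and invariance it suffices to work at a
rectangular diagonal matrix `S` with entries `s k`, `s k ^ 2 = λ k`. Sign flips fixing `S` show that
the gradient there is diagonal and that the directions `(a, k)` and `(a, l)`, `k ≠ l`, are
orthogonal for the Hessian. In a diagonal direction only one eigenvalue moves
(`derivatives_rectDiag_diag`). In an off-diagonal direction, differentiating the invariance under
infinitesimal rotations, `Dh(Y)(J Y) = 0 = Dh(Y)(Y K)` for skew `J` and `K`, once more in `Y`
expresses the Hessian by the gradient (`hessian_rectDiag_offDiag`):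
`(λ k - λ a) ∂²h = 2 (λ k ∂H/∂λ k - λ a ∂H/∂λ a)`. Summing over `a` gives the diagonal of `D`
(`sum_hessian_rectDiag`).
-/

namespace MatrixRisk
open Topology Filter
variable {n p : ℕ}

/-! ### The Gaussian law of a matrix -/

instance instBorelSpaceMatrix : BorelSpace (Matrix (Fin n) (Fin p) ℝ) :=
  inferInstanceAs (BorelSpace (Fin n → Fin p → ℝ))

/-- `Matrix` carries its topology twice, as a matrix space and through the entrywise supremum norm;
the two agree only after unfolding, so the Borel property is recorded for both. -/
instance instBorelSpaceMatrixNorm :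
    @BorelSpace (Matrix (Fin n) (Fin p) ℝ)
      (NormedAddCommGroup.toMetricSpace.toPseudoMetricSpace.toUniformSpace.toTopologicalSpace) _ :=
  inferInstanceAs (BorelSpace (Fin n → Fin p → ℝ))

instance instIsAddHaarMeasureLebesgueMatrix : (lebesgueMatrix n p).IsAddHaarMeasure := by
  have : (Measure.pi fun _ : Fin p => (volume : Measure ℝ)).IsAddHaarMeasure := inferInstance
  exact inferInstanceAs (Measure.IsAddHaarMeasure
    (Measure.pi fun _ : Fin n => Measure.pi fun _ : Fin p => (volume : Measure ℝ)))

instance instIsAddHaarMeasureLebesgueMatrixNorm :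
    @Measure.IsAddHaarMeasure (Matrix (Fin n) (Fin p) ℝ)
      (NormedAddCommGroup.toAddCommGroup.toAddGroup)
      (NormedAddCommGroup.toMetricSpace.toPseudoMetricSpace.toUniformSpace.toTopologicalSpace) _
      (lebesgueMatrix n p) :=
  instIsAddHaarMeasureLebesgueMatrix

instance instIsProbabilityMeasureGaussianMatrix (M : Matrix (Fin n) (Fin p) ℝ) :
    IsProbabilityMeasure (gaussianMatrix M) := by
  have : ∀ a, IsProbabilityMeasure (Measure.pi fun i => gaussianReal (M a i) 1) :=
    fun a => inferInstance
  unfold gaussianMatrix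
  exact Measure.pi.instIsProbabilityMeasure (fun a => Measure.pi fun i => gaussianReal (M a i) 1)

/-- A product of measures with densities has the product of the densities as its density. -/
theorem pi_withDensity_ofReal {ι : Type*} [Fintype ι] {E : Type*}
    [MeasurableSpace E] (μ : ι → Measure E) [∀ i, SigmaFinite (μ i)]
    (f : ι → E → ℝ) (hf : ∀ i, Integrable (f i) (μ i))
    (h0 : ∀ i x, 0 ≤ f i x) :
    Measure.pi (fun i => (μ i).withDensity fun x => ENNReal.ofReal (f i x)) =
      (Measure.pi μ).withDensity fun x => ENNReal.ofReal (∏ i, f i (x i)) := by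
  have hfin : ∀ i, IsFiniteMeasure ((μ i).withDensity fun x => ENNReal.ofReal (f i x)) :=
    fun i => isFiniteMeasure_withDensity_ofReal (hf i).2
  refine Measure.pi_eq fun s hs => ?_
  have hpi : MeasurableSet (Set.univ.pi s) := MeasurableSet.univ_pi hs
  have hI : ∀ i, Integrable ((s i).indicator (f i)) (μ i) := fun i => (hf i).indicator (hs i)
  have hn : ∀ i x, 0 ≤ (s i).indicator (f i) x := fun i x =>
    Set.indicator_nonneg (fun y _ => h0 i y) x
  have key : ∀ x : ι → E, (Set.univ.pi s).indicator (fun x => ENNReal.ofReal (∏ i, f i (x i))) x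
      = ENNReal.ofReal (∏ i, (s i).indicator (f i) (x i)) := by
    intro x
    by_cases hx : x ∈ Set.univ.pi s
    · rw [Set.indicator_of_mem hx]
      congr 1
      refine Finset.prod_congr rfl fun i _ => ?_
      rw [Set.indicator_of_mem (hx i (Set.mem_univ i))]
    · rw [Set.indicator_of_notMem hx]
      simp only [Set.mem_pi, Set.mem_univ, forall_const, not_forall] at hx
      obtain ⟨i, hi⟩ := hx
      rw [Finset.prod_eq_zero (Finset.mem_univ i) (Set.indicator_of_notMem hi _)]
      simp
  rw [withDensity_apply _ hpi, ← lintegral_indicator hpi]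
  simp_rw [key]
  rw [← ofReal_integral_eq_lintegral_ofReal (Integrable.fintype_prod hI)
    (ae_of_all _ fun x => Finset.prod_nonneg fun i _ => hn i (x i)),
    integral_fintype_prod_eq_prod, ENNReal.ofReal_prod_of_nonneg
      (fun i _ => integral_nonneg (hn i))]
  refine Finset.prod_congr rfl fun i _ => ?_
  rw [withDensity_apply _ (hs i), ← lintegral_indicator (hs i),
    ofReal_integral_eq_lintegral_ofReal (hI i) (ae_of_all _ (hn i))]
  refine lintegral_congr fun x => ?_
  by_cases hx : x ∈ s i <;> simp [hx]

/-- The Lebesgue density of `gaussianMatrix M`. -/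
noncomputable def gaussianDensity (M X : Matrix (Fin n) (Fin p) ℝ) : ℝ :=
  ∏ a, ∏ i, gaussianPDFReal (M a i) 1 (X a i)

theorem gaussianMatrix_eq_withDensity (M : Matrix (Fin n) (Fin p) ℝ) :
    gaussianMatrix M =
      (lebesgueMatrix n p).withDensity fun X => ENNReal.ofReal (gaussianDensity M X) := by
  have h1 : ∀ a, (Measure.pi fun i => gaussianReal (M a i) 1) =
      (Measure.pi fun _ : Fin p => (volume : Measure ℝ)).withDensity
        fun x => ENNReal.ofReal (∏ i, gaussianPDFReal (M a i) 1 (x i)) := fun a => by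
    rw [← pi_withDensity_ofReal _ _ (fun i => integrable_gaussianPDFReal (M a i) 1)
      (fun i x => gaussianPDFReal_nonneg _ _ _)]
    simp only [gaussianReal_of_var_ne_zero _ one_ne_zero]
    rfl
  unfold gaussianMatrix lebesgueMatrix gaussianDensity
  simp_rw [h1]
  exact pi_withDensity_ofReal (fun _ : Fin n => Measure.pi fun _ : Fin p => (volume : Measure ℝ))
    (fun a x => ∏ i, gaussianPDFReal (M a i) 1 (x i))
    (fun a => Integrable.fintype_prod fun i => integrable_gaussianPDFReal (M a i) 1)
    (fun a x => Finset.prod_nonneg fun i _ => gaussianPDFReal_nonneg _ _ _)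

theorem gaussianDensity_eq (M X : Matrix (Fin n) (Fin p) ℝ) :
    gaussianDensity M X = (∏ _a : Fin n, ∏ _i : Fin p, (√(2 * Real.pi))⁻¹) *
      Real.exp (-(∑ a, ∑ i, (X a i - M a i) ^ 2) / 2) := by
  simp only [gaussianDensity, gaussianPDFReal_def, NNReal.coe_one, mul_one,
    Finset.prod_mul_distrib, ← Real.exp_sum]
  congr 2
  rw [neg_div, Finset.sum_div, ← Finset.sum_neg_distrib]
  refine Finset.sum_congr rfl fun a _ => ?_
  rw [Finset.sum_div, ← Finset.sum_neg_distrib]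
  exact Finset.sum_congr rfl fun i _ => by ring

theorem gaussianDensity_nonneg (M X : Matrix (Fin n) (Fin p) ℝ) : 0 ≤ gaussianDensity M X :=
  Finset.prod_nonneg fun _ _ => Finset.prod_nonneg fun _ _ => gaussianPDFReal_nonneg _ _ _

theorem contDiff_entry {k : WithTop ℕ∞} (a : Fin n) (i : Fin p) :
    ContDiff ℝ k fun X : Matrix (Fin n) (Fin p) ℝ => X a i :=
  contDiff_apply_apply ℝ ℝ a i

theorem contDiff_gaussianDensity (M : Matrix (Fin n) (Fin p) ℝ) :
    ContDiff ℝ ∞ (gaussianDensity M) := by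
  have h : gaussianDensity M = _ := funext (gaussianDensity_eq M)
  rw [h]
  refine contDiff_const.mul (Real.contDiff_exp.comp ?_)
  refine ContDiff.div_const (ContDiff.neg ?_) 2
  exact ContDiff.sum fun a _ => ContDiff.sum fun i _ =>
    ((contDiff_entry a i).sub contDiff_const).pow 2

/-- The score of the Gaussian density: `∂ρ/∂X a i = -(X - M) a i * ρ`. -/
theorem hasLineDerivAt_gaussianDensity (M X : Matrix (Fin n) (Fin p) ℝ) (a : Fin n) (i : Fin p) :
    HasLineDerivAt ℝ (gaussianDensity M) (-(X a i - M a i) * gaussianDensity M X) X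
      (Matrix.single a i 1) := by
  unfold HasLineDerivAt
  have h : ∀ t : ℝ, gaussianDensity M (X + t • Matrix.single a i (1 : ℝ)) =
      (∏ _a : Fin n, ∏ _i : Fin p, (√(2 * Real.pi))⁻¹) *
      Real.exp (-(∑ b, ∑ j, (X b j + t * (Matrix.single a i (1 : ℝ) b j) - M b j) ^ 2) / 2) := by
    intro t
    rw [gaussianDensity_eq]
    rfl
  simp_rw [h]
  have hs : HasDerivAt (fun t : ℝ =>
      ∑ b, ∑ j, (X b j + t * (Matrix.single a i (1 : ℝ) b j) - M b j) ^ 2)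
      (∑ b, ∑ j, 2 * (X b j - M b j) * Matrix.single a i (1 : ℝ) b j) 0 := by
    refine HasDerivAt.fun_sum fun b _ => HasDerivAt.fun_sum fun j _ => ?_
    have h1 := ((((hasDerivAt_id (0 : ℝ)).mul_const (Matrix.single a i (1 : ℝ) b j)).const_add
      (X b j)).sub_const (M b j)).pow 2
    refine h1.congr_deriv ?_
    simp
  have h2 : (∑ b, ∑ j, 2 * (X b j - M b j) * Matrix.single a i (1 : ℝ) b j) =
      2 * (X a i - M a i) := by
    rw [Finset.sum_eq_single a, Finset.sum_eq_single i]
    · simp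
    · intro j _ hj; simp [hj.symm]
    · simp
    · intro b _ hb; simp [hb.symm]
    · simp
  rw [h2] at hs
  have h3 := ((hs.neg.div_const 2).exp).const_mul
    (∏ _a : Fin n, ∏ _i : Fin p, (√(2 * Real.pi))⁻¹)
  refine h3.congr_deriv ?_
  rw [gaussianDensity_eq]
  simp
  ring

theorem integral_gaussianMatrix (M : Matrix (Fin n) (Fin p) ℝ)
    (f : Matrix (Fin n) (Fin p) ℝ → ℝ) :
    ∫ X, f X ∂(gaussianMatrix M) = ∫ X, gaussianDensity M X * f X ∂(lebesgueMatrix n p) := by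
  rw [gaussianMatrix_eq_withDensity, integral_withDensity_eq_integral_toReal_smul]
  · refine integral_congr_ae (ae_of_all _ fun X => ?_)
    simp [ENNReal.toReal_ofReal (gaussianDensity_nonneg M X)]
  · exact (ENNReal.measurable_ofReal.comp (contDiff_gaussianDensity M).continuous.measurable)
  · simp

theorem gaussianMatrix_absolutelyContinuous (M : Matrix (Fin n) (Fin p) ℝ) :
    gaussianMatrix M ≪ lebesgueMatrix n p := by
  rw [gaussianMatrix_eq_withDensity]
  exact withDensity_absolutelyContinuous _ _

/-- The law of a row of a Gaussian matrix. -/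
theorem measurePreserving_row (M : Matrix (Fin n) (Fin p) ℝ) (a : Fin n) :
    MeasurePreserving (fun X : Matrix (Fin n) (Fin p) ℝ => X a) (gaussianMatrix M)
      (Measure.pi fun i => gaussianReal (M a i) 1) := by
  have : ∀ a, IsProbabilityMeasure (Measure.pi fun i => gaussianReal (M a i) 1) :=
    fun a => Measure.pi.instIsProbabilityMeasure _
  exact measurePreserving_eval (fun a => Measure.pi fun i => gaussianReal (M a i) 1) a

theorem measurePreserving_entry (M : Matrix (Fin n) (Fin p) ℝ) (a : Fin n) (i : Fin p) :
    MeasurePreserving (fun X : Matrix (Fin n) (Fin p) ℝ => X a i) (gaussianMatrix M)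
      (gaussianReal (M a i) 1) :=
  (measurePreserving_eval (fun i => gaussianReal (M a i) 1) i).comp
    (measurePreserving_row M a)

theorem memLp_entry_sub (M : Matrix (Fin n) (Fin p) ℝ) (a : Fin n) (i : Fin p) :
    MemLp (fun X : Matrix (Fin n) (Fin p) ℝ => X a i - M a i) 2 (gaussianMatrix M) := by
  have h : MemLp (fun x : ℝ => x - M a i) 2 (gaussianReal (M a i) 1) :=
    (memLp_id_gaussianReal 2).sub (memLp_const _)
  exact h.comp_measurePreserving (measurePreserving_entry M a i)

/-- The rows of a Gaussian matrix have identity covariance. -/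
theorem integral_entry_sub_mul (M : Matrix (Fin n) (Fin p) ℝ) (a : Fin n) (i j : Fin p) :
    ∫ X, (X a i - M a i) * (X a j - M a j) ∂(gaussianMatrix M) = if i = j then 1 else 0 := by
  have hpush := measurePreserving_row M a
  have hmean : ∀ i, ∫ x, (x - M a i) ∂(gaussianReal (M a i) 1) = 0 := fun i => by
    rw [integral_sub _ (integrable_const _), integral_id_gaussianReal]
    · simp
    · exact (memLp_id_gaussianReal 1).integrable le_rfl
  split_ifs with hij
  · subst hij
    have hv : ∫ x, (x - M a i) ^ 2 ∂(gaussianReal (M a i) 1) = 1 := by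
      have h := variance_id_gaussianReal (μ := M a i) (v := 1)
      rw [variance_eq_integral (by fun_prop)] at h
      simpa [integral_id_gaussianReal] using h
    rw [← (measurePreserving_entry M a i).map_eq, integral_map] at hv
    · simpa [sq] using hv
    · exact (measurePreserving_entry M a i).measurable.aemeasurable
    · exact Continuous.aestronglyMeasurable (by fun_prop)
  · have hind : IndepFun (fun x : Fin p → ℝ => x i - M a i) (fun x : Fin p → ℝ => x j - M a j)
        (Measure.pi fun i => gaussianReal (M a i) 1) :=
      (iIndepFun_pi (μ := fun i => gaussianReal (M a i) 1) (X := fun i x => x - M a i)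
        (fun i => by fun_prop)).indepFun hij
    have hm : ∀ k, ∫ x : Fin p → ℝ, (x k - M a k) ∂(Measure.pi fun i => gaussianReal (M a i) 1)
        = 0 := fun k => by
      have h := hmean k
      rw [← (measurePreserving_eval (fun i => gaussianReal (M a i) 1) k).map_eq,
        integral_map] at h
      · exact h
      · exact (measurable_pi_apply k).aemeasurable
      · exact Continuous.aestronglyMeasurable (by fun_prop)
    have h1 := hind.integral_fun_mul_eq_mul_integral
      (Continuous.aestronglyMeasurable (by fun_prop)) (Continuous.aestronglyMeasurable (by fun_prop))
    rw [hm i, hm j, mul_zero, ← hpush.map_eq, integral_map] at h1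
    · exact h1
    · exact hpush.measurable.aemeasurable
    · exact Continuous.aestronglyMeasurable (by fun_prop)

/-! ### Weak derivatives and Stein's identity -/

/-- Where `u` is continuously differentiable, a weak directional derivative agrees with the
classical one. -/
theorem ae_eq_fderiv_of_weak {E : Type*} [NormedAddCommGroup E] [NormedSpace ℝ E]
    [FiniteDimensional ℝ E] [MeasurableSpace E] [BorelSpace E] {μ : Measure E}
    [μ.IsAddHaarMeasure] {O : Set E} (hO : IsOpen O) {u w : E → ℝ} {v : E}
    (hu : ∀ x ∈ O, ContDiffAt ℝ 1 u x) (hw : LocallyIntegrable w μ)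
    (hweak : ∀ φ : E → ℝ, ContDiff ℝ ∞ φ → HasCompactSupport φ →
      ∫ x, u x * lineDeriv ℝ φ x v ∂μ = -∫ x, w x * φ x ∂μ) :
    ∀ᵐ x ∂μ, x ∈ O → w x = fderiv ℝ u x v := by
  have hcu : ∀ x ∈ O, ContinuousAt (fun x => fderiv ℝ u x v) x := fun x hx =>
    (((hu x hx).fderiv_right (m := 0) (by simp)).clm_apply contDiffAt_const).continuousAt
  have hloc : LocallyIntegrableOn (fun x => fderiv ℝ u x v) O μ :=
    ContinuousOn.locallyIntegrableOn (fun x hx => (hcu x hx).continuousWithinAt) hO.measurableSet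
  have key := hO.ae_eq_zero_of_integral_contDiff_smul_eq_zero (μ := μ)
    (f := fun x => w x - fderiv ℝ u x v)
    ((hw.locallyIntegrableOn O).sub hloc) ?_
  · filter_upwards [key] with x hx hxO
    exact sub_eq_zero.1 (hx hxO)
  intro φ hφ hφc hφO
  have hd : ∀ x, HasLineDerivAt ℝ φ (lineDeriv ℝ φ x v) x v := fun x =>
    ((hφ.differentiable (by simp)) x).lineDifferentiableAt.hasLineDerivAt
  have hdc : Continuous fun x => lineDeriv ℝ φ x v := by
    have : (fun x => lineDeriv ℝ φ x v) = fun x => fderiv ℝ φ x v :=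
      funext fun x => ((hφ.differentiable (by simp)) x).lineDeriv_eq_fderiv
    rw [this]
    exact (hφ.continuous_fderiv (by simp)).clm_apply continuous_const
  have hds : tsupport (fun x => lineDeriv ℝ φ x v) ⊆ tsupport φ := by
    refine closure_minimal (fun x hx => ?_) (isClosed_tsupport φ)
    by_contra hxs
    apply hx
    have h0 : φ =ᶠ[𝓝 x] fun _ => (0 : ℝ) := by
      filter_upwards [(isClosed_tsupport φ).isOpen_compl.mem_nhds hxs] with y hy
      exact image_eq_zero_of_notMem_tsupport hy
    change lineDeriv ℝ φ x v = 0
    rw [((hφ.differentiable (by simp)) x).lineDeriv_eq_fderiv, h0.fderiv_eq]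
    simp
  -- a function continuous on `O` times a test function supported in `O` is integrable
  have hint : ∀ f ψ : E → ℝ, (∀ x ∈ O, ContinuousAt f x) → Continuous ψ →
      tsupport ψ ⊆ tsupport φ → Integrable (fun x => f x * ψ x) μ := by
    intro f ψ hf hψ hs
    have hs' : tsupport (fun x => f x * ψ x) ⊆ tsupport ψ := tsupport_mul_subset_right
    have hψc : HasCompactSupport ψ := hφc.of_isClosed_subset (isClosed_tsupport ψ) hs
    refine Continuous.integrable_of_hasCompactSupport ?_ hψc.mul_left
    exact continuous_of_tsupport fun x hx =>
      (hf x (hφO (hs (hs' hx)))).mul hψ.continuousAt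
  have huc : ∀ x ∈ O, ContinuousAt u x := fun x hx => (hu x hx).continuousAt
  have hibp := integral_bilinear_hasLineDerivAt_right_eq_neg_left_of_integrable (μ := μ)
    (f := u) (f' := fun x => fderiv ℝ u x v) (g := φ) (g' := fun x => lineDeriv ℝ φ x v) (v := v)
    (B := ContinuousLinearMap.mul ℝ ℝ)
    (hint _ _ hcu hφ.continuous subset_rfl) (hint _ _ huc hdc hds)
    (hint _ _ huc hφ.continuous subset_rfl)
    (fun x hx => (((hu x (hφO hx)).differentiableAt (by simp)).hasFDerivAt.hasLineDerivAt v))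
    (fun x _ => hd x)
  simp only [ContinuousLinearMap.mul_apply'] at hibp
  have h1 := hweak φ hφ hφc
  have hwi : Integrable (fun x => φ x • w x) μ :=
    hw.integrable_smul_left_of_hasCompactSupport hφ.continuous hφc
  have hui := hint _ _ hcu hφ.continuous subset_rfl
  have : (fun x => φ x • (w x - fderiv ℝ u x v)) =
      fun x => φ x • w x - fderiv ℝ u x v * φ x := by
    funext x; simp [mul_sub, mul_comm]
  rw [this, integral_sub hwi hui]
  simp only [smul_eq_mul, mul_comm (φ _)]
  linarith

/-- Smooth cutoffs with gradients tending uniformly to zero. -/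
theorem exists_cutoff (E : Type*) [NormedAddCommGroup E] [NormedSpace ℝ E]
    [FiniteDimensional ℝ E] :
    ∃ (χ : ℕ → E → ℝ) (C : ℝ), (∀ R, ContDiff ℝ ∞ (χ R)) ∧ (∀ R, HasCompactSupport (χ R)) ∧
      (∀ R x, ‖χ R x‖ ≤ 1) ∧ (∀ R x, ‖fderiv ℝ (χ R) x‖ ≤ C / ((R : ℝ) + 1)) ∧
      ∀ x, Tendsto (fun R => χ R x) atTop (𝓝 1) := by
  let b : ContDiffBump (0 : E) := ⟨1, 2, one_pos, one_lt_two⟩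
  have hb : ContDiff ℝ ∞ b := b.contDiff
  obtain ⟨C, hC⟩ : ∃ C, ∀ x, ‖fderiv ℝ b x‖ ≤ C :=
    (hb.continuous_fderiv (by simp)).bounded_above_of_compact_support
      (b.hasCompactSupport.fderiv ℝ)
  have hpos : ∀ R : ℕ, (0 : ℝ) < (R : ℝ) + 1 := fun R => by positivity
  refine ⟨fun R x => b (((R : ℝ) + 1)⁻¹ • x), C, fun R => ?_, fun R => ?_, fun R x => ?_,
    fun R x => ?_, fun x => ?_⟩
  · exact hb.comp (contDiff_const_smul _)
  · exact b.hasCompactSupport.comp_smul (inv_ne_zero (hpos R).ne')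
  · rw [Real.norm_of_nonneg b.nonneg]
    exact b.le_one
  · rw [fderiv_comp_smul, norm_smul, norm_inv, Real.norm_of_nonneg (hpos R).le, div_eq_inv_mul]
    exact mul_le_mul_of_nonneg_left (hC _) (inv_nonneg.2 (hpos R).le)
  · refine tendsto_const_nhds.congr' ?_
    obtain ⟨N, hN⟩ := exists_nat_ge ‖x‖
    filter_upwards [eventually_ge_atTop N] with R hR
    refine (b.one_of_mem_closedBall ?_).symm
    have hR' : (N : ℝ) ≤ R := by exact_mod_cast hR
    rw [mem_closedBall_zero_iff, norm_smul, norm_inv, Real.norm_of_nonneg (hpos R).le,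
      inv_mul_le_iff₀ (hpos R)]
    change ‖x‖ ≤ ((R : ℝ) + 1) * 1
    linarith

/-- **Stein's identity** for the divergence of a column field. Only the divergence, not the
individual weak derivatives, has to be integrable: this is what the risk formula controls. -/
theorem integral_gaussianMatrix_stein (M : Matrix (Fin n) (Fin p) ℝ) (i : Fin p)
    (g w : Fin n → Matrix (Fin n) (Fin p) ℝ → ℝ)
    (hw : ∀ a, HasWeakPartial (g a) (w a) a i)
    (hg : ∀ a, MemLp (g a) 2 (gaussianMatrix M))
    (hS : Integrable (fun X => ∑ a, w a X) (gaussianMatrix M)) :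
    ∫ X, ∑ a, (X a i - M a i) * g a X ∂(gaussianMatrix M) =
      ∫ X, ∑ a, w a X ∂(gaussianMatrix M) := by
  obtain ⟨χ, C, hχ, hχc, hχ1, hχd, hχt⟩ := exists_cutoff (Matrix (Fin n) (Fin p) ℝ)
  have hρ := contDiff_gaussianDensity M
  set F : Matrix (Fin n) (Fin p) ℝ → ℝ := fun X => ∑ a, (X a i - M a i) * g a X
  have hxg : ∀ a, Integrable (fun X => (X a i - M a i) * g a X) (gaussianMatrix M) := fun a =>
    (memLp_entry_sub M a i).integrable_mul (hg a)
  have hFi : Integrable F (gaussianMatrix M) := integrable_finsetSum _ fun a _ => hxg a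
  have hgi : ∀ a, Integrable (g a) (gaussianMatrix M) := fun a =>
    (hg a).integrable (by norm_num)
  let d : ℕ → Fin n → Matrix (Fin n) (Fin p) ℝ → ℝ := fun R a X =>
    fderiv ℝ (χ R) X (Matrix.single a i 1)
  have hdc : ∀ R a, Continuous (d R a) := fun R a =>
    ((hχ R).continuous_fderiv (by simp)).clm_apply continuous_const
  let K : Fin n → ℝ := fun a => ‖(Matrix.single a i 1 : Matrix (Fin n) (Fin p) ℝ)‖
  have hdb : ∀ R a X, ‖d R a X‖ ≤ C / ((R : ℝ) + 1) * K a := fun R a X =>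
    ((fderiv ℝ (χ R) X).le_opNorm _).trans
      (mul_le_mul_of_nonneg_right (hχd R X) (norm_nonneg _))
  have hgd : ∀ R a, Integrable (fun X => g a X * d R a X) (gaussianMatrix M) := fun R a =>
    (hgi a).mul_bdd (hdc R a).aestronglyMeasurable (ae_of_all _ (hdb R a))
  have hχm : ∀ R, AEStronglyMeasurable (χ R) (gaussianMatrix M) := fun R =>
    (hχ R).continuous.aestronglyMeasurable
  -- the weak derivative tested against `χ R * ρ`
  have hR : ∀ R, ∑ a, ∫ X, g a X * d R a X ∂(gaussianMatrix M)
      - ∫ X, F X * χ R X ∂(gaussianMatrix M)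
      = -∫ X, (∑ a, w a X) * χ R X ∂(gaussianMatrix M) := by
    intro R
    have htest : IsTestFunction fun X => χ R X * gaussianDensity M X :=
      ⟨(hχ R).mul hρ, (hχc R).mul_right⟩
    have hder : ∀ a X, matrixPartial (fun X => χ R X * gaussianDensity M X) a i X =
        gaussianDensity M X * (d R a X - (X a i - M a i) * χ R X) := by
      intro a X
      have h1 : HasLineDerivAt ℝ (χ R) (d R a X) X (Matrix.single a i 1) :=
        (((hχ R).differentiable (by simp)) X).hasFDerivAt.hasLineDerivAt _
      have h2 := hasLineDerivAt_gaussianDensity M X a i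
      have h3 : HasLineDerivAt ℝ (fun X => χ R X * gaussianDensity M X)
          (d R a X * gaussianDensity M X +
            χ R X * (-(X a i - M a i) * gaussianDensity M X)) X (Matrix.single a i 1) := by
        refine (HasDerivAt.fun_mul h1 h2).congr_deriv ?_
        simp
      rw [matrixPartial, h3.lineDeriv]
      ring
    have hone : ∀ a, ∫ X, g a X * d R a X ∂(gaussianMatrix M)
        - ∫ X, (X a i - M a i) * g a X * χ R X ∂(gaussianMatrix M)
        = -∫ X, w a X * (χ R X * gaussianDensity M X) ∂(lebesgueMatrix n p) := by
      intro a
      rw [← (hw a).2 _ htest, ← integral_sub (hgd R a)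
        ((hxg a).mul_bdd (hχm R) (ae_of_all _ (hχ1 R))), integral_gaussianMatrix]
      refine integral_congr_ae (ae_of_all _ fun X => ?_)
      simp only [hder]
      ring
    have hwi : ∀ a, Integrable (fun X => w a X * (χ R X * gaussianDensity M X))
        (lebesgueMatrix n p) := fun a => by
      have h := (hw a).1.integrable_smul_left_of_hasCompactSupport
        htest.1.continuous htest.2
      simpa [mul_comm] using h
    have hsum := Finset.sum_congr (rfl : (Finset.univ : Finset (Fin n)) = _) fun a _ => hone a
    rw [Finset.sum_sub_distrib, Finset.sum_neg_distrib, ← integral_finsetSum _ (fun a _ => hwi a),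
      ← integral_finsetSum _
        (fun a _ => (hxg a).mul_bdd (hχm R) (ae_of_all _ (hχ1 R)))] at hsum
    rw [integral_gaussianMatrix M fun X => (∑ a, w a X) * χ R X]
    have e1 : ∀ X, F X * χ R X = ∑ a, (X a i - M a i) * g a X * χ R X := fun X =>
      Finset.sum_mul _ _ _
    have e2 : ∀ X, gaussianDensity M X * ((∑ a, w a X) * χ R X) =
        ∑ a, w a X * (χ R X * gaussianDensity M X) := fun X => by
      rw [← Finset.sum_mul]
      ring
    simp only [e1, e2]
    exact hsum
  have hlim : ∀ f : Matrix (Fin n) (Fin p) ℝ → ℝ, Integrable f (gaussianMatrix M) →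
      Tendsto (fun R => ∫ X, f X * χ R X ∂(gaussianMatrix M)) atTop
        (𝓝 (∫ X, f X ∂(gaussianMatrix M))) := by
    intro f hf
    refine tendsto_integral_of_dominated_convergence (fun X => ‖f X‖)
      (fun R => hf.aestronglyMeasurable.mul (hχm R)) hf.norm (fun R => ae_of_all _ fun X => ?_)
      (ae_of_all _ fun X => ?_)
    · rw [norm_mul]
      exact mul_le_of_le_one_right (norm_nonneg _) (hχ1 R X)
    · simpa using (hχt X).const_mul (f X)
  have hzero : Tendsto (fun R => ∑ a, ∫ X, g a X * d R a X ∂(gaussianMatrix M)) atTop (𝓝 0) := by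
    rw [← Finset.sum_const_zero (s := (Finset.univ : Finset (Fin n)))]
    refine tendsto_finsetSum _ fun a _ => ?_
    have hC : Tendsto (fun R : ℕ => C / ((R : ℝ) + 1) * K a *
        ∫ X, ‖g a X‖ ∂(gaussianMatrix M)) atTop (𝓝 0) := by
      have := (tendsto_const_div_atTop_nhds_zero_nat C).comp (tendsto_add_atTop_nat 1)
      have := (this.mul_const (K a)).mul_const (∫ X, ‖g a X‖ ∂(gaussianMatrix M))
      simpa [Function.comp_def] using this
    refine squeeze_zero_norm (fun R => ?_) hC
    rw [← integral_const_mul]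
    refine norm_integral_le_of_norm_le ((hgi a).norm.const_mul _) (ae_of_all _ fun X => ?_)
    rw [norm_mul, mul_comm]
    exact mul_le_mul_of_nonneg_right (hdb R a X) (norm_nonneg _)
  have hl := hzero.sub (hlim F hFi)
  simp_rw [hR] at hl
  have := tendsto_nhds_unique hl (hlim _ hS).neg
  linarith

/-! ### Generic spectra -/

namespace IsSpectralDecomposition

variable {A V : Matrix (Fin p) (Fin p) ℝ} {lam : Fin p → ℝ}

theorem transpose_mul (hd : IsSpectralDecomposition A V lam) : Vᵀ * V = 1 :=
  (Matrix.mem_orthogonalGroup_iff' _ _).1 hd.orthogonal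

theorem mul_transpose (hd : IsSpectralDecomposition A V lam) : V * Vᵀ = 1 :=
  (Matrix.mem_orthogonalGroup_iff _ _).1 hd.orthogonal

theorem pow_eq (hd : IsSpectralDecomposition A V lam) (m : ℕ) :
    A ^ m = V * Matrix.diagonal (fun k => lam k ^ m) * Vᵀ := by
  induction m with
  | zero => simp [hd.mul_transpose]
  | succ m ih =>
    have h : Matrix.diagonal (fun k => lam k ^ (m + 1)) =
        Matrix.diagonal (fun k => lam k ^ m) * Matrix.diagonal lam := by
      rw [Matrix.diagonal_mul_diagonal]
      simp [pow_succ]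
    rw [pow_succ, ih, h]
    conv_lhs => rw [hd.eq]
    calc _ = V * Matrix.diagonal (fun k => lam k ^ m) * (Vᵀ * V) * Matrix.diagonal lam * Vᵀ := by
          simp only [Matrix.mul_assoc]
      _ = _ := by rw [hd.transpose_mul]; simp only [Matrix.mul_assoc, Matrix.mul_one]

theorem trace_pow (hd : IsSpectralDecomposition A V lam) (m : ℕ) :
    (A ^ m).trace = ∑ k, lam k ^ m := by
  rw [hd.pow_eq, Matrix.trace_mul_comm, ← Matrix.mul_assoc, hd.transpose_mul, Matrix.one_mul,
    Matrix.trace_diagonal]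

theorem det_smul_one_sub (hd : IsSpectralDecomposition A V lam) (t : ℝ) :
    (t • (1 : Matrix (Fin p) (Fin p) ℝ) - A).det = ∏ k, (t - lam k) := by
  have h : t • (1 : Matrix (Fin p) (Fin p) ℝ) - A =
      V * Matrix.diagonal (fun k => t - lam k) * Vᵀ := by
    have h1 : Matrix.diagonal (fun k => t - lam k) =
        t • (1 : Matrix (Fin p) (Fin p) ℝ) - Matrix.diagonal lam := by
      rw [Matrix.smul_one_eq_diagonal, Matrix.diagonal_sub]
    rw [h1, Matrix.mul_sub, Matrix.sub_mul, ← hd.eq, Matrix.mul_smul, Matrix.smul_mul,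
      Matrix.mul_one, hd.mul_transpose]
  rw [h, Matrix.det_mul, Matrix.det_mul, mul_right_comm, ← Matrix.det_mul, hd.mul_transpose,
    Matrix.det_one, one_mul, Matrix.det_diagonal]

variable {X : Matrix (Fin n) (Fin p) ℝ}

theorem gram_eq_diagonal (hd : IsSpectralDecomposition (Xᵀ * X) V lam) :
    (X * V)ᵀ * (X * V) = Matrix.diagonal lam := by
  calc (X * V)ᵀ * (X * V) = Vᵀ * (Xᵀ * X) * V := by
        rw [Matrix.transpose_mul]; simp only [Matrix.mul_assoc]
    _ = (Vᵀ * V) * Matrix.diagonal lam * (Vᵀ * V) := by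
        rw [hd.eq]; simp only [Matrix.mul_assoc]
    _ = _ := by rw [hd.transpose_mul]; simp

theorem nonneg (hd : IsSpectralDecomposition (Xᵀ * X) V lam) (k : Fin p) : 0 ≤ lam k := by
  have h := congrFun (congrFun hd.gram_eq_diagonal k) k
  rw [Matrix.diagonal_apply_eq, Matrix.mul_apply] at h
  rw [← h]
  exact Finset.sum_nonneg fun a _ => mul_self_nonneg _

/-- `Xᵀ X` has rank at most `n`. -/
theorem eq_zero_of_le (hd : IsSpectralDecomposition (Xᵀ * X) V lam) {k : Fin p} (hk : n ≤ k) :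
    lam k = 0 := by
  by_contra hne
  have h1 : (Matrix.diagonal lam).rank ≤ n := by
    rw [← hd.gram_eq_diagonal]
    exact (Matrix.rank_mul_le_right _ _).trans (Matrix.rank_le_height _)
  rw [Matrix.rank_diagonal] at h1
  have h2 : (Finset.Iic k).card ≤ Fintype.card {i // lam i ≠ 0} := by
    rw [Fintype.card_subtype]
    refine Finset.card_le_card fun j hj => ?_
    have hkj := hd.antitone (Finset.mem_Iic.1 hj)
    have hpos : 0 < lam k := lt_of_le_of_ne (hd.nonneg k) (Ne.symm hne)
    simp only [Finset.mem_filter, Finset.mem_univ, true_and]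
    exact (hpos.trans_le hkj).ne'
  rw [Fin.card_Iic] at h2
  omega

end IsSpectralDecomposition

/-- The spectrum that `Xᵀ X` has for almost every `n × p` matrix `X`: the first `min n p`
eigenvalues are positive and distinct, the others vanish. -/
structure IsGenericSpectrum (n : ℕ) (lam : Fin p → ℝ) : Prop where
  pos : ∀ k : Fin p, (k : ℕ) < n → 0 < lam k
  zero : ∀ k : Fin p, n ≤ (k : ℕ) → lam k = 0
  strict : ∀ k l : Fin p, (k : ℕ) < n → k < l → lam l < lam k

theorem IsGenericSpectrum.ne {lam : Fin p → ℝ} (hg : IsGenericSpectrum n lam) {k l : Fin p}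
    (hk : (k : ℕ) < n) (hkl : k ≠ l) : lam k ≠ lam l := by
  rcases lt_or_gt_of_ne hkl with h | h
  · exact (hg.strict k l hk h).ne'
  · exact (hg.strict l k (lt_trans h hk) h).ne

theorem IsGenericSpectrum.antitone {lam : Fin p → ℝ} (hg : IsGenericSpectrum n lam) :
    Antitone lam := by
  intro k l hkl
  rcases hkl.eq_or_lt with rfl | hkl
  · exact le_rfl
  · rcases lt_or_ge (k : ℕ) n with hk | hk
    · exact (hg.strict k l hk hkl).le
    · rw [hg.zero k hk, hg.zero l (hk.trans (Fin.le_def.1 hkl.le))]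

/-- A generic spectrum is determined by its positive entries being eigenvalues: the sorted
eigenvalues of `A`, at most `n` of them nonzero, can only be these. -/
theorem IsGenericSpectrum.eq {A V : Matrix (Fin p) (Fin p) ℝ} {lam ν : Fin p → ℝ}
    (hν : IsGenericSpectrum n ν) (hd : IsSpectralDecomposition A V lam)
    (h0 : ∀ k : Fin p, n ≤ (k : ℕ) → lam k = 0)
    (hroot : ∀ k : Fin p, (k : ℕ) < n →
      (ν k • (1 : Matrix (Fin p) (Fin p) ℝ) - A).det = 0) : lam = ν := by
  have hex : ∀ k : {k : Fin p // (k : ℕ) < n}, ∃ l : {k : Fin p // (k : ℕ) < n},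
      lam l = ν k := by
    rintro ⟨k, hk⟩
    have h := hroot k hk
    rw [hd.det_smul_one_sub, Finset.prod_eq_zero_iff] at h
    obtain ⟨l, -, hl⟩ := h
    refine ⟨⟨l, ?_⟩, (sub_eq_zero.1 hl).symm⟩
    by_contra hln
    rw [h0 l (not_lt.1 hln), sub_zero] at hl
    exact (hν.pos k hk).ne' hl
  choose σ hσ using hex
  have hmono : StrictMono σ := by
    intro k l hkl
    by_contra hlt
    have h1 : lam (σ k) ≤ lam (σ l) := hd.antitone (not_lt.1 hlt)
    rw [hσ, hσ] at h1
    exact absurd (hν.strict k l k.2 hkl) (not_lt.2 h1)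
  funext k
  by_cases hk : (k : ℕ) < n
  · have h1 : σ ⟨k, hk⟩ = ⟨k, hk⟩ := le_antisymm hmono.apply_le hmono.le_apply
    have h2 := hσ ⟨k, hk⟩
    rwa [h1] at h2
  · rw [h0 k (not_lt.1 hk), hν.zero k (not_lt.1 hk)]

/-- The determinant of the Hankel matrix of the traces of powers of `Xᵀ X`. It is a polynomial in
the entries of `X`, and in terms of the first `min n p` eigenvalues of `Xᵀ X` it is their product
times the square of their Vandermonde determinant. -/
def gramHankel {R : Type*} [CommRing R] (X : Matrix (Fin n) (Fin p) R) : R :=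
  (Matrix.of fun i j : Fin (min n p) => ((Xᵀ * X) ^ ((i : ℕ) + j + 1)).trace).det

theorem gramHankel_map {R S : Type*} [CommRing R] [CommRing S] (f : R →+* S)
    (X : Matrix (Fin n) (Fin p) R) : gramHankel (X.map f) = f (gramHankel X) := by
  rw [gramHankel, gramHankel, RingHom.map_det]
  congr 1
  ext i j
  simp only [RingHom.mapMatrix_apply, Matrix.map_apply, Matrix.of_apply]
  rw [← Matrix.transpose_map, ← Matrix.map_mul, AddMonoidHom.map_trace f]
  congr 1
  exact (map_pow f.mapMatrix (Xᵀ * X) _).symm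

theorem gramHankel_smul {R : Type*} [CommRing R] (c : R) (X : Matrix (Fin n) (Fin p) R) :
    ∃ m : ℕ, gramHankel (c • X) = c ^ m * gramHankel X := by
  have h : gramHankel (c • X) = (∏ i : Fin (min n p), c ^ (2 * (i : ℕ) + 2)) *
      ((∏ j : Fin (min n p), c ^ (2 * (j : ℕ))) * gramHankel X) := by
    rw [gramHankel, gramHankel, ← Matrix.det_mul_row, ← Matrix.det_mul_column]
    congr 1
    ext i j
    simp only [Matrix.of_apply, Matrix.transpose_smul, Matrix.smul_mul, Matrix.mul_smul, smul_smul,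
      smul_pow, Matrix.trace_smul, smul_eq_mul]
    ring
  refine ⟨∑ i : Fin (min n p), (2 * (i : ℕ) + 2) + ∑ j : Fin (min n p), (2 * (j : ℕ)), ?_⟩
  rw [h, Finset.prod_pow_eq_pow_sum, Finset.prod_pow_eq_pow_sum, pow_add, mul_assoc]

theorem gramHankel_eq {V : Matrix (Fin p) (Fin p) ℝ} {lam : Fin p → ℝ}
    {X : Matrix (Fin n) (Fin p) ℝ} (hd : IsSpectralDecomposition (Xᵀ * X) V lam) :
    gramHankel X = (∏ k : Fin (min n p), lam (k.castLE (min_le_right n p))) *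
      (Matrix.vandermonde fun k : Fin (min n p) => lam (k.castLE (min_le_right n p))).det ^ 2 := by
  set x : Fin (min n p) → ℝ := fun k => lam (k.castLE (min_le_right n p))
  have h : (Matrix.of fun i j : Fin (min n p) => ((Xᵀ * X) ^ ((i : ℕ) + j + 1)).trace) =
      (Matrix.vandermonde x)ᵀ * Matrix.diagonal x * Matrix.vandermonde x := by
    ext i j
    rw [Matrix.of_apply, hd.trace_pow, Matrix.mul_apply]
    symm
    refine Finset.sum_of_injOn (fun k : Fin (min n p) => k.castLE (min_le_right n p))
      (fun k _ l _ hkl => Fin.castLE_injective _ hkl) (fun _ _ => Finset.mem_univ _) ?_ ?_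
    · intro k _ hk
      rw [hd.eq_zero_of_le, zero_pow (Nat.succ_ne_zero _)]
      by_contra hlt
      exact hk ⟨⟨k, lt_min (not_le.1 hlt) k.2⟩, Finset.mem_coe.2 (Finset.mem_univ _), rfl⟩
    · intro k _
      rw [Matrix.mul_diagonal, Matrix.transpose_apply, Matrix.vandermonde_apply,
        Matrix.vandermonde_apply]
      ring
  rw [gramHankel, h, Matrix.det_mul, Matrix.det_mul, Matrix.det_transpose, Matrix.det_diagonal]
  ring

theorem gramHankel_ne_zero_iff {V : Matrix (Fin p) (Fin p) ℝ} {lam : Fin p → ℝ}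
    {X : Matrix (Fin n) (Fin p) ℝ} (hd : IsSpectralDecomposition (Xᵀ * X) V lam) :
    gramHankel X ≠ 0 ↔ IsGenericSpectrum n lam := by
  rw [gramHankel_eq hd, mul_ne_zero_iff, Finset.prod_ne_zero_iff, pow_ne_zero_iff two_ne_zero,
    Matrix.det_vandermonde_ne_zero_iff]
  constructor
  · rintro ⟨h1, h2⟩
    have hpos : ∀ k : Fin p, (k : ℕ) < n → 0 < lam k := fun k hk =>
      lt_of_le_of_ne (hd.nonneg k) (Ne.symm (h1 ⟨k, lt_min hk k.2⟩ (Finset.mem_univ _)))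
    refine ⟨hpos, fun k hk => hd.eq_zero_of_le hk, fun k l hk hkl => ?_⟩
    rcases lt_or_ge (l : ℕ) n with hl | hl
    · refine lt_of_le_of_ne (hd.antitone hkl.le) fun heq => hkl.ne' ?_
      have := @h2 ⟨l, lt_min hl l.2⟩ ⟨k, lt_min hk k.2⟩ heq
      exact Fin.ext (Fin.mk.inj this)
    · rw [hd.eq_zero_of_le hl]
      exact hpos k hk
  · intro hg
    refine ⟨fun k _ => (hg.pos _ (lt_of_lt_of_le k.2 (min_le_left _ _))).ne', fun k l hkl => ?_⟩
    by_contra hne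
    exact hg.ne (lt_of_lt_of_le k.2 (min_le_left _ _))
      (fun h => hne (Fin.castLE_injective _ h)) hkl

/-- The rectangular diagonal matrix with diagonal entries `s`. -/
def rectDiag (n : ℕ) (s : Fin p → ℝ) : Matrix (Fin n) (Fin p) ℝ :=
  Matrix.of fun a k => if (a : ℕ) = k then s k else 0

theorem rectDiag_transpose_mul_self {s : Fin p → ℝ} (hs : ∀ k : Fin p, n ≤ (k : ℕ) → s k = 0) :
    (rectDiag n s)ᵀ * rectDiag n s = Matrix.diagonal fun k => s k ^ 2 := by
  ext k l
  rw [Matrix.mul_apply]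
  simp only [Matrix.transpose_apply, rectDiag, Matrix.of_apply, Matrix.diagonal_apply]
  rcases lt_or_ge (k : ℕ) n with hk | hk
  · rw [Finset.sum_eq_single (⟨k, hk⟩ : Fin n)]
    · by_cases hkl : k = l
      · subst hkl; simp [sq]
      · have : (k : ℕ) ≠ l := fun h => hkl (Fin.ext h)
        simp [hkl, this]
    · intro a _ ha
      have : (a : ℕ) ≠ k := fun h => ha (Fin.ext h)
      simp [this]
    · simp
  · rw [Finset.sum_eq_zero]
    · simp [hs k hk]
    · intro a _
      have : (a : ℕ) ≠ k := by omega
      simp [this]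

theorem isSpectralDecomposition_rectDiag {s : Fin p → ℝ}
    (hs : ∀ k : Fin p, n ≤ (k : ℕ) → s k = 0) (hanti : Antitone fun k => s k ^ 2) :
    IsSpectralDecomposition ((rectDiag n s)ᵀ * rectDiag n s) 1 fun k => s k ^ 2 where
  orthogonal := one_mem _
  antitone := hanti
  eq := by simp [rectDiag_transpose_mul_self hs]

theorem exists_gramHankel_ne_zero (n p : ℕ) :
    ∃ X : Matrix (Fin n) (Fin p) ℝ, gramHankel X ≠ 0 := by
  let s : Fin p → ℝ := fun k => if (k : ℕ) < n then (p : ℝ) - k else 0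
  have hs0 : ∀ k : Fin p, n ≤ (k : ℕ) → s k = 0 := fun k hk => if_neg (not_lt.2 hk)
  have hs1 : ∀ k : Fin p, (k : ℕ) < n → s k = (p : ℝ) - k := fun k hk => if_pos hk
  have hlt : ∀ k : Fin p, (k : ℝ) < p := fun k => by exact_mod_cast k.2
  have hg : IsGenericSpectrum n fun k => s k ^ 2 := by
    have hpos : ∀ k : Fin p, (k : ℕ) < n → 0 < s k := fun k hk => by
      rw [hs1 k hk]; linarith [hlt k]
    refine ⟨fun k hk => pow_pos (hpos k hk) 2, fun k hk => by simp [hs0 k hk],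
      fun k l hk hkl => ?_⟩
    rcases lt_or_ge (l : ℕ) n with hl | hl
    · have hkl' : (k : ℝ) < l := by exact_mod_cast hkl
      have : s l < s k := by rw [hs1 k hk, hs1 l hl]; linarith
      exact pow_lt_pow_left₀ this (hpos l hl).le two_ne_zero
    · simpa [hs0 l hl] using pow_pos (hpos k hk) 2
  exact ⟨rectDiag n s,
    (gramHankel_ne_zero_iff (isSpectralDecomposition_rectDiag hs0 hg.antitone)).2 hg⟩

theorem continuous_gramHankel : Continuous (gramHankel (R := ℝ) (n := n) (p := p)) := by
  unfold gramHankel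
  refine Continuous.matrix_det (continuous_matrix fun i j => ?_)
  simp only [Matrix.of_apply]
  refine Continuous.matrix_trace ?_
  exact (continuous_id.matrix_transpose.matrix_mul continuous_id).pow _

/-- A nonzero homogeneous polynomial vanishes only on a null set: it has finitely many zeros on
every line whose direction is not a zero. -/
theorem ae_gramHankel_ne_zero (n p : ℕ) :
    ∀ᵐ X ∂(lebesgueMatrix n p), gramHankel X ≠ 0 := by
  obtain ⟨X₀, hX₀⟩ := exists_gramHankel_ne_zero n p
  have hmeas : MeasurableSet {X : Matrix (Fin n) (Fin p) ℝ | gramHankel X ≠ 0} :=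
    (isOpen_ne_fun continuous_gramHankel continuous_const).measurableSet
  refine ae_mem_of_ae_add_linearMap_mem (LinearMap.toSpanSingleton ℝ _ X₀) (volume : Measure ℝ)
    (lebesgueMatrix n p) hmeas fun Y => ?_
  -- the zeros of `gramHankel (Y + t • X₀)` are `0` and inverses of zeros of `q`
  let q : Polynomial ℝ := gramHankel
    (X₀.map Polynomial.C + (Polynomial.X : Polynomial ℝ) • Y.map Polynomial.C)
  have hq : ∀ s : ℝ, q.eval s = gramHankel (X₀ + s • Y) := fun s => by
    have h := gramHankel_map (Polynomial.evalRingHom s)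
      (X₀.map Polynomial.C + (Polynomial.X : Polynomial ℝ) • Y.map Polynomial.C)
    rw [Polynomial.coe_evalRingHom] at h
    rw [← h]
    congr 1
    ext a k
    simp only [Matrix.map_apply, Matrix.add_apply, Matrix.smul_apply, smul_eq_mul,
      Polynomial.eval_add, Polynomial.eval_mul, Polynomial.eval_C,
      Polynomial.eval_X]
  have hq0 : q ≠ 0 := by
    rintro h
    have := hq 0
    rw [h] at this
    simp at this
    exact hX₀ this.symm
  have hfin : ({0} ∪ (fun t : ℝ => t⁻¹) ⁻¹' {s | q.IsRoot s} : Set ℝ).Finite :=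
    (Set.finite_singleton 0).union
      ((Polynomial.finite_setOfPred_isRoot hq0).preimage inv_injective.injOn)
  rw [ae_iff]
  refine measure_mono_null (fun t ht => ?_) (hfin.measure_zero volume)
  by_cases ht0 : t = 0
  · exact Or.inl ht0
  · right
    have h1 : gramHankel (Y + t • X₀) = 0 := not_not.1 ht
    have h2 : Y + t • X₀ = t • (X₀ + t⁻¹ • Y) := by
      rw [smul_add, smul_smul, mul_inv_cancel₀ ht0, one_smul, add_comm]
    obtain ⟨m, hm⟩ := gramHankel_smul t (X₀ + t⁻¹ • Y)
    rw [h2, hm] at h1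
    change q.eval t⁻¹ = 0
    rw [hq]
    exact (mul_eq_zero.1 h1).resolve_left (pow_ne_zero m ht0)

/-! ### Smoothness of simple eigenvalues -/

theorem contDiff_det_smul_one_sub {k : WithTop ℕ∞} :
    ContDiff ℝ k fun z : Matrix (Fin n) (Fin p) ℝ × ℝ =>
      (z.2 • (1 : Matrix (Fin p) (Fin p) ℝ) - z.1ᵀ * z.1).det := by
  simp only [Matrix.det_apply]
  refine ContDiff.sum fun σ _ => ContDiff.const_smul _ (contDiff_prod fun i _ => ?_)
  simp only [Matrix.sub_apply, Matrix.smul_apply, smul_eq_mul, Matrix.mul_apply,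
    Matrix.transpose_apply]
  refine (contDiff_snd.mul contDiff_const).sub (ContDiff.sum fun a _ => ?_)
  exact ((contDiff_entry a _).comp contDiff_fst).mul ((contDiff_entry a _).comp contDiff_fst)

/-- A simple eigenvalue of `Xᵀ X` extends to a smooth root of the characteristic polynomial, by the
implicit function theorem. -/
theorem exists_contDiffAt_eigenvalue {X₀ : Matrix (Fin n) (Fin p) ℝ}
    {V : Matrix (Fin p) (Fin p) ℝ} {lam : Fin p → ℝ}
    (hd : IsSpectralDecomposition (X₀ᵀ * X₀) V lam) (k : Fin p)
    (hk : ∀ l, l ≠ k → lam k ≠ lam l) :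
    ∃ ψ : Matrix (Fin n) (Fin p) ℝ → ℝ, ContDiffAt ℝ 2 ψ X₀ ∧ ψ X₀ = lam k ∧
      ∀ᶠ X in 𝓝 X₀, (ψ X • (1 : Matrix (Fin p) (Fin p) ℝ) - Xᵀ * X).det = 0 := by
  set f : Matrix (Fin n) (Fin p) ℝ × ℝ → ℝ := fun z =>
    (z.2 • (1 : Matrix (Fin p) (Fin p) ℝ) - z.1ᵀ * z.1).det with hf
  have hcd : ContDiffAt ℝ 2 f (X₀, lam k) := contDiff_det_smul_one_sub.contDiffAt
  have hval : ∀ t, f (X₀, t) = (t - lam k) * ∏ l ∈ Finset.univ.erase k, (t - lam l) := fun t => by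
    rw [hf]
    simp only [hd.det_smul_one_sub]
    rw [← Finset.mul_prod_erase _ _ (Finset.mem_univ k)]
  set c : ℝ := ∏ l ∈ Finset.univ.erase k, (lam k - lam l) with hc
  have hc0 : c ≠ 0 := Finset.prod_ne_zero_iff.2 fun l hl =>
    sub_ne_zero.2 (hk l (Finset.ne_of_mem_erase hl))
  have hder : HasDerivAt (fun t => f (X₀, t)) c (lam k) := by
    simp_rw [hval]
    have h1 : HasDerivAt (fun t : ℝ => t - lam k) 1 (lam k) := (hasDerivAt_id _).sub_const _
    have h2 : DifferentiableAt ℝ (fun t : ℝ => ∏ l ∈ Finset.univ.erase k, (t - lam l)) (lam k) :=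
      by fun_prop
    refine (h1.fun_mul h2.hasDerivAt).congr_deriv ?_
    simp [hc]
  have hder' : HasDerivAt (fun t => f (X₀, t))
      ((fderiv ℝ f (X₀, lam k) ∘L .inr ℝ _ ℝ) 1) (lam k) := by
    have h1 : HasFDerivAt f (fderiv ℝ f (X₀, lam k)) (X₀, lam k) :=
      (hcd.differentiableAt two_ne_zero).hasFDerivAt
    have h2 : HasFDerivAt (fun t : ℝ => (X₀, t)) (ContinuousLinearMap.inr ℝ _ ℝ) (lam k) :=
      hasFDerivAt_prodMk_right X₀ (lam k)
    exact (h1.comp (lam k) h2).hasDerivAt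
  have hinv : (fderiv ℝ f (X₀, lam k) ∘L .inr ℝ _ ℝ).IsInvertible := by
    refine ⟨ContinuousLinearEquiv.unitsEquivAut ℝ (Units.mk0 c hc0), ?_⟩
    ext
    rw [← hder.unique hder']
    simp
  refine ⟨hcd.implicitFunction two_ne_zero hinv,
    hcd.contDiffAt_implicitFunction two_ne_zero hinv,
    hcd.implicitFunction_apply_self two_ne_zero hinv, ?_⟩
  filter_upwards [hcd.eventually_apply_implicitFunction two_ne_zero hinv] with X hX
  have h0 : f (X₀, lam k) = 0 := by rw [hval]; simp
  rw [h0] at hX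
  exact hX

/-- Among spectra whose last entries vanish, being generic is an open condition. -/
theorem IsGenericSpectrum.eventually {α : Type*} {f : Filter α} {lam : Fin p → ℝ}
    (hg : IsGenericSpectrum n lam) {ν : Fin p → α → ℝ}
    (hν : ∀ k, Tendsto (ν k) f (𝓝 (lam k))) (hz : ∀ x (k : Fin p), n ≤ (k : ℕ) → ν k x = 0) :
    ∀ᶠ x in f, IsGenericSpectrum n fun k => ν k x := by
  have h1 : ∀ᶠ x in f, ∀ k : Fin p, (k : ℕ) < n → 0 < ν k x := by
    refine eventually_all.2 fun k => ?_
    by_cases hk : (k : ℕ) < n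
    · filter_upwards [(hν k).eventually_const_lt (hg.pos k hk)] with x hx _ using hx
    · exact Eventually.of_forall fun x h => absurd h hk
  have h2 : ∀ᶠ x in f, ∀ k l : Fin p, (k : ℕ) < n → k < l → ν l x < ν k x := by
    refine eventually_all.2 fun k => eventually_all.2 fun l => ?_
    by_cases hk : (k : ℕ) < n ∧ k < l
    · filter_upwards [(hν l).eventually_lt (hν k) (hg.strict k l hk.1 hk.2)] with x hx _ _ using hx
    · exact Eventually.of_forall fun x h h' => absurd ⟨h, h'⟩ hk
  filter_upwards [h1, h2] with x hx1 hx2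
  exact ⟨hx1, hz x, hx2⟩

/-- Near a matrix with generic spectrum the sorted eigenvalues are smooth. -/
theorem contDiffAt_spectrum
    {V : Matrix (Fin n) (Fin p) ℝ → Matrix (Fin p) (Fin p) ℝ}
    {lam : Matrix (Fin n) (Fin p) ℝ → Fin p → ℝ}
    (hspec : ∀ X, IsSpectralDecomposition (Xᵀ * X) (V X) (lam X))
    {X₀ : Matrix (Fin n) (Fin p) ℝ} (hg : IsGenericSpectrum n (lam X₀)) :
    ContDiffAt ℝ 2 lam X₀ := by
  have hex : ∀ k : Fin p, ∃ ψ : Matrix (Fin n) (Fin p) ℝ → ℝ, ContDiffAt ℝ 2 ψ X₀ ∧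
      ψ X₀ = lam X₀ k ∧ ((n ≤ (k : ℕ) → ψ = fun _ => 0) ∧ ((k : ℕ) < n →
      ∀ᶠ X in 𝓝 X₀, (ψ X • (1 : Matrix (Fin p) (Fin p) ℝ) - Xᵀ * X).det = 0)) := by
    intro k
    rcases lt_or_ge (k : ℕ) n with hk | hk
    · obtain ⟨ψ, h1, h2, h3⟩ := exists_contDiffAt_eigenvalue (hspec X₀) k
        (fun l hl => hg.ne hk hl.symm)
      exact ⟨ψ, h1, h2, fun h => absurd hk (not_lt.2 h), fun _ => h3⟩
    · exact ⟨fun _ => 0, contDiffAt_const, (hg.zero k hk).symm, fun _ => rfl,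
        fun h => absurd h (not_lt.2 hk)⟩
  choose ψ hψ hψ0 hψz hψr using hex
  have hcont : ∀ k, Tendsto (ψ k) (𝓝 X₀) (𝓝 (lam X₀ k)) := fun k => by
    rw [← hψ0 k]
    exact (hψ k).continuousAt
  have hgen : ∀ᶠ X in 𝓝 X₀, IsGenericSpectrum n fun k => ψ k X :=
    hg.eventually hcont fun X k hk => by rw [hψz k hk]
  have hroot : ∀ᶠ X in 𝓝 X₀, ∀ k : Fin p, (k : ℕ) < n →
      (ψ k X • (1 : Matrix (Fin p) (Fin p) ℝ) - Xᵀ * X).det = 0 := by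
    refine eventually_all.2 fun k => ?_
    by_cases hk : (k : ℕ) < n
    · filter_upwards [hψr k hk] with X hX _ using hX
    · exact Eventually.of_forall fun X h => absurd h hk
  have heq : lam =ᶠ[𝓝 X₀] fun X k => ψ k X := by
    filter_upwards [hgen, hroot] with X hX1 hX2
    exact hX1.eq (hspec X) (fun k hk => (hspec X).eq_zero_of_le hk) hX2
  exact (contDiffAt_pi.2 hψ).congr_of_eventuallyEq heq

/-! ### Derivatives of invariant functions and plane rotations -/

section InvariantFunctions

variable {E : Type*} [NormedAddCommGroup E] [NormedSpace ℝ E] {f : E → ℝ} {x : E}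

theorem eventually_differentiableAt (hf : ContDiffAt ℝ 2 f x) :
    ∀ᶠ y in 𝓝 x, DifferentiableAt ℝ f y :=
  (hf.eventually (by simp)).mono fun _ hy => hy.differentiableAt two_ne_zero

theorem hasFDerivAt_fderiv (hf : ContDiffAt ℝ 2 f x) :
    HasFDerivAt (fderiv ℝ f) (fderiv ℝ (fderiv ℝ f) x) x :=
  ((hf.fderiv_right (m := 1) (by norm_num)).differentiableAt one_ne_zero).hasFDerivAt

theorem hasFDerivAt_fderiv_apply (hf : ContDiffAt ℝ 2 f x) (v : E) :
    HasFDerivAt (fun y => fderiv ℝ f y v) ((fderiv ℝ (fderiv ℝ f) x).flip v) x := by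
  have := (hasFDerivAt_fderiv hf).clm_apply (hasFDerivAt_const v x)
  simpa using this

/-- Second-order chain rule along a line on which `f` is `g` along a curve of the form
`c t = c₀ + q t • u`. -/
theorem fderiv_line_eq {F : Type*} [NormedAddCommGroup F] [NormedSpace ℝ F] {g : F → ℝ}
    {v : E} {c₀ u : F} {q : ℝ → ℝ} {q' : ℝ → ℝ} {q'' : ℝ}
    (hf : ContDiffAt ℝ 2 f x) (hg : ContDiffAt ℝ 2 g c₀) (hq0 : q 0 = 0)
    (hq : ∀ t, HasDerivAt q (q' t) t) (hq' : HasDerivAt q' q'' 0)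
    (heq : ∀ᶠ t : ℝ in 𝓝 0, f (x + t • v) = g (c₀ + q t • u)) :
    fderiv ℝ f x v = q' 0 * fderiv ℝ g c₀ u ∧
      fderiv ℝ (fderiv ℝ f) x v v =
        q'' * fderiv ℝ g c₀ u + q' 0 ^ 2 * fderiv ℝ (fderiv ℝ g) c₀ u u := by
  have hl : ∀ t : ℝ, HasDerivAt (fun t : ℝ => x + t • v) v t := fun t => by
    simpa using ((hasDerivAt_id t).smul_const v).const_add x
  have hc : ∀ t : ℝ, HasDerivAt (fun t : ℝ => c₀ + q t • u) (q' t • u) t := fun t =>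
    ((hq t).smul_const u).const_add c₀
  have hl0 : x + (0 : ℝ) • v = x := by simp
  have hc0 : c₀ + q 0 • u = c₀ := by simp [hq0]
  have e1 : ∀ᶠ t : ℝ in 𝓝 0, DifferentiableAt ℝ f (x + t • v) := by
    refine (hl 0).continuousAt.eventually ?_
    simp only [hl0]
    exact eventually_differentiableAt hf
  have e2 : ∀ᶠ t : ℝ in 𝓝 0, DifferentiableAt ℝ g (c₀ + q t • u) := by
    refine (hc 0).continuousAt.eventually ?_
    simp only [hc0]
    exact eventually_differentiableAt hg
  have e3 : ∀ᶠ t : ℝ in 𝓝 0,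
      fderiv ℝ f (x + t • v) v = q' t * fderiv ℝ g (c₀ + q t • u) u := by
    filter_upwards [e1, e2, heq.eventually_nhds] with t h1 h2 h3
    have d1 : HasDerivAt (fun t : ℝ => f (x + t • v)) (fderiv ℝ f (x + t • v) v) t :=
      h1.hasFDerivAt.comp_hasDerivAt t (hl t)
    have d2 : HasDerivAt (fun t : ℝ => g (c₀ + q t • u))
        (fderiv ℝ g (c₀ + q t • u) (q' t • u)) t := h2.hasFDerivAt.comp_hasDerivAt t (hc t)
    rw [d1.unique (d2.congr_of_eventuallyEq h3), map_smul, smul_eq_mul]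
  constructor
  · have := e3.self_of_nhds
    rwa [hl0, hc0] at this
  · have hf' : HasFDerivAt (fun y => fderiv ℝ f y v) ((fderiv ℝ (fderiv ℝ f) x).flip v)
        (x + (0 : ℝ) • v) := by rw [hl0]; exact hasFDerivAt_fderiv_apply hf v
    have hg' : HasFDerivAt (fun y => fderiv ℝ g y u) ((fderiv ℝ (fderiv ℝ g) c₀).flip u)
        (c₀ + q 0 • u) := by rw [hc0]; exact hasFDerivAt_fderiv_apply hg u
    have d1 := hf'.comp_hasDerivAt (0 : ℝ) (hl 0)
    have d2 := hq'.fun_mul (hg'.comp_hasDerivAt (0 : ℝ) (hc 0))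
    have h := d1.unique (d2.congr_of_eventuallyEq e3)
    simp only [Function.comp_apply, ContinuousLinearMap.flip_apply, hc0, map_smul,
      smul_eq_mul] at h
    rw [h]
    ring

variable [FiniteDimensional ℝ E]

theorem fderiv_apply_of_invariant {L : E → E} (hlin : IsLinearMap ℝ L) (hL : ∀ y, f (L y) = f y)
    (hf : DifferentiableAt ℝ f (L x)) (v : E) : fderiv ℝ f x v = fderiv ℝ f (L x) (L v) := by
  obtain ⟨L', rfl⟩ : ∃ L' : E →L[ℝ] E, L = L' :=
    ⟨LinearMap.toContinuousLinearMap (IsLinearMap.mk' L hlin), rfl⟩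
  have h1 : HasFDerivAt (fun y => f (L' y)) ((fderiv ℝ f (L' x)).comp L') x :=
    hf.hasFDerivAt.comp x L'.hasFDerivAt
  simp_rw [hL] at h1
  rw [h1.fderiv]
  rfl

theorem fderiv_fderiv_apply_of_invariant {L : E → E} (hlin : IsLinearMap ℝ L)
    (hL : ∀ y, f (L y) = f y) (hf : ContDiffAt ℝ 2 f (L x)) (v w : E) :
    fderiv ℝ (fderiv ℝ f) x v w = fderiv ℝ (fderiv ℝ f) (L x) (L v) (L w) := by
  obtain ⟨L', rfl⟩ : ∃ L' : E →L[ℝ] E, L = L' :=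
    ⟨LinearMap.toContinuousLinearMap (IsLinearMap.mk' L hlin), rfl⟩
  have hfx : ContDiffAt ℝ 2 f x := by
    have := hf.comp x L'.contDiff.contDiffAt
    exact this.congr_of_eventuallyEq (Eventually.of_forall fun y => (hL y).symm)
  have h1 : (fun y => fderiv ℝ f y w) =ᶠ[𝓝 x] fun y => fderiv ℝ f (L' y) (L' w) := by
    filter_upwards [L'.continuous.continuousAt.eventually (eventually_differentiableAt hf)]
      with y hy
    exact fderiv_apply_of_invariant hlin hL hy w
  have h2 := (hasFDerivAt_fderiv_apply hf (L' w)).comp x L'.hasFDerivAt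
  have h3 := (h2.congr_of_eventuallyEq h1).unique (hasFDerivAt_fderiv_apply hfx w)
  exact (DFunLike.congr_fun h3 v).symm

/-- At a fixed point of a symmetry of `f`, the gradient vanishes in the directions that the
symmetry reverses. -/
theorem fderiv_apply_eq_zero_of_reversed {L : E → E} (hlin : IsLinearMap ℝ L)
    (hL : ∀ y, f (L y) = f y) (hx : L x = x) (hf : DifferentiableAt ℝ f x) {v : E}
    (hv : L v = (-1 : ℝ) • v) : fderiv ℝ f x v = 0 := by
  have h := fderiv_apply_of_invariant hlin hL (by rwa [hx]) v
  rw [hx, hv, map_smul, smul_eq_mul] at h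
  linarith

/-- At a fixed point of a symmetry of `f`, two eigendirections of the symmetry whose eigenvalues
do not have product one are orthogonal for the Hessian. -/
theorem fderiv_fderiv_apply_eq_zero_of_scaled {L : E → E} (hlin : IsLinearMap ℝ L)
    (hL : ∀ y, f (L y) = f y) (hx : L x = x) (hf : ContDiffAt ℝ 2 f x) {v w : E} {c d : ℝ}
    (hcd : c * d ≠ 1) (hv : L v = c • v) (hw : L w = d • w) :
    fderiv ℝ (fderiv ℝ f) x v w = 0 := by
  have h := fderiv_fderiv_apply_of_invariant hlin hL (by rwa [hx]) v w
  rw [hx, hv, hw, map_smul, map_smul, _root_.smul_apply, smul_eq_mul, smul_eq_mul] at h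
  have h' : (c * d - 1) * fderiv ℝ (fderiv ℝ f) x v w = 0 := by linarith
  exact (mul_eq_zero.1 h').resolve_left (sub_ne_zero.2 hcd)

/-- If `f` is constant along the flow of the linear vector field `J`, differentiating
`fderiv ℝ f y (J y) = 0` expresses the Hessian in the direction `J x` by the gradient. -/
theorem fderiv_fderiv_apply_of_field {J : E → E} (hlin : IsLinearMap ℝ J)
    (hf : ContDiffAt ℝ 2 f x)
    (hJ : ∀ y, DifferentiableAt ℝ f y → fderiv ℝ f y (J y) = 0) (v : E) :
    fderiv ℝ (fderiv ℝ f) x v (J x) = -fderiv ℝ f x (J v) := by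
  obtain ⟨J', rfl⟩ : ∃ J' : E →L[ℝ] E, J = J' :=
    ⟨LinearMap.toContinuousLinearMap (IsLinearMap.mk' J hlin), rfl⟩
  have h1 : HasFDerivAt (fun y => fderiv ℝ f y (J' y)) _ x :=
    (hasFDerivAt_fderiv hf).clm_apply J'.hasFDerivAt
  have h0 : (fun y => fderiv ℝ f y (J' y)) =ᶠ[𝓝 x] fun _ => 0 := by
    filter_upwards [eventually_differentiableAt hf] with y hy using hJ y hy
  have h2 := (h1.congr_of_eventuallyEq h0.symm).unique (hasFDerivAt_const (0 : ℝ) x)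
  have h3 := DFunLike.congr_fun h2 v
  simp only [_root_.add_apply, ContinuousLinearMap.comp_apply,
    ContinuousLinearMap.flip_apply, _root_.zero_apply] at h3
  linarith

end InvariantFunctions

section PlaneRotations

variable {m : ℕ}

/-- The generator of the rotations in the coordinate plane `(a, b)`. -/
def planeSkew (a b : Fin m) : Matrix (Fin m) (Fin m) ℝ :=
  Matrix.single a b 1 - Matrix.single b a 1

theorem planeSkew_transpose (a b : Fin m) : (planeSkew a b)ᵀ = -planeSkew a b := by
  simp [planeSkew]

theorem planeSkew_mul_self {a b : Fin m} (hab : a ≠ b) :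
    planeSkew a b * planeSkew a b = -(Matrix.single a a 1 + Matrix.single b b 1) := by
  simp [planeSkew, Matrix.sub_mul, Matrix.mul_sub, hab, hab.symm]
  abel

theorem planeSkew_mul_self_mul {a b : Fin m} (hab : a ≠ b) :
    planeSkew a b * planeSkew a b * planeSkew a b = -planeSkew a b := by
  rw [planeSkew_mul_self hab]
  simp [planeSkew, Matrix.add_mul, Matrix.mul_sub, hab, hab.symm]
  abel

/-- Rotation by the angle `t` in the coordinate plane `(a, b)`: the exponential of
`t • planeSkew a b`, in the closed form that `J ^ 3 = -J` gives. -/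
noncomputable def planeRotation (a b : Fin m) (t : ℝ) : Matrix (Fin m) (Fin m) ℝ :=
  1 + Real.sin t • planeSkew a b + (1 - Real.cos t) • (planeSkew a b * planeSkew a b)

theorem planeRotation_mem_orthogonalGroup {a b : Fin m} (hab : a ≠ b) (t : ℝ) :
    planeRotation a b t ∈ Matrix.orthogonalGroup (Fin m) ℝ := by
  rw [Matrix.mem_orthogonalGroup_iff]
  have h3 := planeSkew_mul_self_mul hab
  have ht := planeSkew_transpose a b
  unfold planeRotation
  set J := planeSkew a b
  set K := J * J with hK
  have hKt : Kᵀ = K := by rw [hK, Matrix.transpose_mul, ht, neg_mul_neg]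
  have hJK : J * K = -J := by rw [hK, ← Matrix.mul_assoc]; exact h3
  have hKK : K * K = -K := by
    calc K * K = J * (J * K) := Matrix.mul_assoc J J K
      _ = -K := by rw [hJK, Matrix.mul_neg]
  simp only [Matrix.transpose_add, Matrix.transpose_smul, Matrix.transpose_one, ht, hKt,
    Matrix.add_mul, Matrix.mul_add, Matrix.smul_mul, Matrix.mul_smul, Matrix.one_mul,
    Matrix.mul_one, Matrix.mul_neg, h3, hJK, hKK, ← hK]
  have hsc := Real.sin_sq_add_cos_sq t
  have key : (2 * (1 - Real.cos t) - Real.sin t ^ 2 - (1 - Real.cos t) ^ 2) • K = 0 := by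
    have : 2 * (1 - Real.cos t) - Real.sin t ^ 2 - (1 - Real.cos t) ^ 2 = 0 := by linarith
    rw [this, zero_smul]
  calc _ = 1 + (2 * (1 - Real.cos t) - Real.sin t ^ 2 - (1 - Real.cos t) ^ 2) • K := by
        module
    _ = 1 := by rw [key, add_zero]

theorem planeRotation_zero (a b : Fin m) : planeRotation a b 0 = 1 := by simp [planeRotation]

end PlaneRotations

/-! ### The derivatives of an invariant function at a rectangular diagonal matrix -/

theorem isLinearMap_mul_mul (P : Matrix (Fin n) (Fin n) ℝ) (Q : Matrix (Fin p) (Fin p) ℝ) :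
    IsLinearMap ℝ fun X : Matrix (Fin n) (Fin p) ℝ => P * X * Q :=
  ⟨fun X Y => by rw [Matrix.mul_add, Matrix.add_mul],
    fun c X => by rw [Matrix.mul_smul, Matrix.smul_mul]⟩

section Rotations

variable {h : Matrix (Fin n) (Fin p) ℝ → ℝ}

/-- The derivative at zero of the orbit of a point under a plane rotation. -/
theorem hasDerivAt_rotation {E : Type*} [NormedAddCommGroup E] [NormedSpace ℝ E] (x y z : E) :
    HasDerivAt (fun t : ℝ => x + Real.sin t • y + (1 - Real.cos t) • z) y 0 := by
  have h1 := ((Real.hasDerivAt_sin 0).smul_const y).const_add x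
  have h2 := ((Real.hasDerivAt_cos 0).const_sub 1).smul_const z
  refine (h1.fun_add h2).congr_deriv ?_
  simp

/-- Left invariance in infinitesimal form. -/
theorem fderiv_planeSkew_mul (hinv : OrthogonallyInvariant h) {a b : Fin n} (hab : a ≠ b)
    {Y : Matrix (Fin n) (Fin p) ℝ} (hY : DifferentiableAt ℝ h Y) :
    fderiv ℝ h Y (planeSkew a b * Y) = 0 := by
  have hc := hasDerivAt_rotation Y (planeSkew a b * Y) (planeSkew a b * planeSkew a b * Y)
  have hr : ∀ t, Y + Real.sin t • (planeSkew a b * Y) +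
      (1 - Real.cos t) • (planeSkew a b * planeSkew a b * Y) = planeRotation a b t * Y := fun t => by
    simp only [planeRotation, Matrix.add_mul, Matrix.one_mul, Matrix.smul_mul]
  simp_rw [hr] at hc
  have h0 : planeRotation a b 0 * Y = Y := by rw [planeRotation_zero, Matrix.one_mul]
  have hY' : HasFDerivAt h (fderiv ℝ h Y) (planeRotation a b 0 * Y) := by
    rw [h0]; exact hY.hasFDerivAt
  have h1 := hY'.comp_hasDerivAt (0 : ℝ) hc
  have h2 : (h ∘ fun t => planeRotation a b t * Y) = fun _ => h Y := by
    funext t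
    have := hinv _ (planeRotation_mem_orthogonalGroup hab t) 1 (one_mem _) Y
    rwa [Matrix.mul_one] at this
  rw [h2] at h1
  exact h1.unique (hasDerivAt_const _ _)

/-- Right invariance in infinitesimal form. -/
theorem fderiv_mul_planeSkew (hinv : OrthogonallyInvariant h) {k l : Fin p} (hkl : k ≠ l)
    {Y : Matrix (Fin n) (Fin p) ℝ} (hY : DifferentiableAt ℝ h Y) :
    fderiv ℝ h Y (Y * planeSkew k l) = 0 := by
  have hc := hasDerivAt_rotation Y (Y * planeSkew k l) (Y * (planeSkew k l * planeSkew k l))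
  have hr : ∀ t, Y + Real.sin t • (Y * planeSkew k l) +
      (1 - Real.cos t) • (Y * (planeSkew k l * planeSkew k l)) = Y * planeRotation k l t :=
    fun t => by
    simp only [planeRotation, Matrix.mul_add, Matrix.mul_one, Matrix.mul_smul]
  simp_rw [hr] at hc
  have h0 : Y * planeRotation k l 0 = Y := by rw [planeRotation_zero, Matrix.mul_one]
  have hY' : HasFDerivAt h (fderiv ℝ h Y) (Y * planeRotation k l 0) := by
    rw [h0]; exact hY.hasFDerivAt
  have h1 := hY'.comp_hasDerivAt (0 : ℝ) hc
  have h2 : (h ∘ fun t => Y * planeRotation k l t) = fun _ => h Y := by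
    funext t
    have := hinv 1 (one_mem _) _ (planeRotation_mem_orthogonalGroup hkl t) Y
    rwa [Matrix.one_mul] at this
  rw [h2] at h1
  exact h1.unique (hasDerivAt_const _ _)

theorem hessian_planeSkew_mul (hinv : OrthogonallyInvariant h) {a b : Fin n} (hab : a ≠ b)
    {Y : Matrix (Fin n) (Fin p) ℝ} (hY : ContDiffAt ℝ 2 h Y) (C : Matrix (Fin n) (Fin p) ℝ) :
    fderiv ℝ (fderiv ℝ h) Y C (planeSkew a b * Y) = -fderiv ℝ h Y (planeSkew a b * C) := by
  exact fderiv_fderiv_apply_of_field (J := fun Z => planeSkew a b * Z)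
    ⟨fun _ _ => Matrix.mul_add _ _ _, fun _ _ => Matrix.mul_smul _ _ _⟩ hY
    (fun Z hZ => fderiv_planeSkew_mul hinv hab hZ) C

theorem hessian_mul_planeSkew (hinv : OrthogonallyInvariant h) {k l : Fin p} (hkl : k ≠ l)
    {Y : Matrix (Fin n) (Fin p) ℝ} (hY : ContDiffAt ℝ 2 h Y) (C : Matrix (Fin n) (Fin p) ℝ) :
    fderiv ℝ (fderiv ℝ h) Y C (Y * planeSkew k l) = -fderiv ℝ h Y (C * planeSkew k l) := by
  exact fderiv_fderiv_apply_of_field (J := fun Z => Z * planeSkew k l)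
    ⟨fun _ _ => Matrix.add_mul _ _ _, fun _ _ => Matrix.smul_mul _ _ _⟩ hY
    (fun Z hZ => fderiv_mul_planeSkew hinv hkl hZ) C

end Rotations

section Reflections

/-- The reflection that flips the sign of the coordinate number `k`, if there is one. -/
def coordReflection (m k : ℕ) : Matrix (Fin m) (Fin m) ℝ :=
  Matrix.diagonal fun a => if (a : ℕ) = k then -1 else 1

theorem coordReflection_mem_orthogonalGroup (m k : ℕ) :
    coordReflection m k ∈ Matrix.orthogonalGroup (Fin m) ℝ := by
  rw [Matrix.mem_orthogonalGroup_iff, coordReflection, Matrix.diagonal_transpose,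
    Matrix.diagonal_mul_diagonal, ← Matrix.diagonal_one]
  congr 1
  funext a
  split_ifs <;> simp

theorem coordReflection_mul_rectDiag_mul (s : Fin p → ℝ) (k : ℕ) :
    coordReflection n k * rectDiag n s * coordReflection p k = rectDiag n s := by
  ext a l
  rw [coordReflection, coordReflection, Matrix.mul_diagonal, Matrix.diagonal_mul]
  simp only [rectDiag, Matrix.of_apply]
  by_cases hal : (a : ℕ) = l
  · rw [hal]
    split_ifs <;> simp
  · simp [hal]

theorem coordReflection_mul_single_mul (a : Fin n) (l : Fin p) (k : ℕ) :
    coordReflection n k * Matrix.single a l (1 : ℝ) * coordReflection p k =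
      ((if (a : ℕ) = k then (-1 : ℝ) else 1) * (if (l : ℕ) = k then -1 else 1)) •
        Matrix.single a l (1 : ℝ) := by
  ext b j
  rw [coordReflection, coordReflection, Matrix.mul_diagonal, Matrix.diagonal_mul,
    Matrix.smul_apply, Matrix.single_apply, smul_eq_mul]
  by_cases hb : a = b ∧ l = j
  · obtain ⟨rfl, rfl⟩ := hb
    simp
  · simp [hb]

variable {h : Matrix (Fin n) (Fin p) ℝ → ℝ} {s : Fin p → ℝ}

/-- Flipping the sign of row and column `k` fixes a diagonal matrix and reverses the direction
`(a, k)`. -/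
theorem fderiv_rectDiag_single_of_ne (hinv : OrthogonallyInvariant h)
    (hd : DifferentiableAt ℝ h (rectDiag n s)) {a : Fin n} {k : Fin p} (hak : (a : ℕ) ≠ k) :
    fderiv ℝ h (rectDiag n s) (Matrix.single a k 1) = 0 := by
  have h1 := coordReflection_mul_single_mul a k k
  rw [if_neg hak, if_pos rfl, one_mul] at h1
  exact fderiv_apply_eq_zero_of_reversed
    (isLinearMap_mul_mul (coordReflection n k) (coordReflection p k))
    (fun Y => hinv _ (coordReflection_mem_orthogonalGroup n k) _
      (coordReflection_mem_orthogonalGroup p k) Y)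
    (coordReflection_mul_rectDiag_mul s k) hd h1

/-- Flipping the sign of row and column `k` multiplies exactly one of the directions `(a, k)` and
`(a, l)` by `-1`, whether `a = k` or not. -/
theorem hessian_rectDiag_single_of_ne (hinv : OrthogonallyInvariant h)
    (hd : ContDiffAt ℝ 2 h (rectDiag n s)) (a : Fin n) {k l : Fin p} (hkl : k ≠ l) :
    fderiv ℝ (fderiv ℝ h) (rectDiag n s) (Matrix.single a k 1) (Matrix.single a l 1) = 0 := by
  have hlk : (l : ℕ) ≠ k := fun h => hkl (Fin.ext h.symm)
  refine fderiv_fderiv_apply_eq_zero_of_scaled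
    (isLinearMap_mul_mul (coordReflection n k) (coordReflection p k))
    (fun Y => hinv _ (coordReflection_mem_orthogonalGroup n k) _
      (coordReflection_mem_orthogonalGroup p k) Y)
    (coordReflection_mul_rectDiag_mul s k) hd ?_ (coordReflection_mul_single_mul a k k)
    (coordReflection_mul_single_mul a l k)
  rw [if_pos rfl, if_neg hlk]
  split_ifs <;> norm_num

end Reflections

section Diagonal

variable {V : Matrix (Fin n) (Fin p) ℝ → Matrix (Fin p) (Fin p) ℝ}
  {lam : Matrix (Fin n) (Fin p) ℝ → Fin p → ℝ}
  {h : Matrix (Fin n) (Fin p) ℝ → ℝ} {H : (Fin p → ℝ) → ℝ} {s : Fin p → ℝ}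

theorem spectrum_rectDiag
    (hspec : ∀ X, IsSpectralDecomposition (Xᵀ * X) (V X) (lam X))
    (hg : IsGenericSpectrum n fun k => s k ^ 2) : lam (rectDiag n s) = fun k => s k ^ 2 := by
  have hs : ∀ k : Fin p, n ≤ (k : ℕ) → s k = 0 := fun k hk =>
    pow_eq_zero_iff two_ne_zero |>.1 (hg.zero k hk)
  refine hg.eq (hspec _) (fun k hk => (hspec _).eq_zero_of_le hk) fun k _ => ?_
  rw [(isSpectralDecomposition_rectDiag hs hg.antitone).det_smul_one_sub]
  exact Finset.prod_eq_zero (Finset.mem_univ k) (sub_self _)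

theorem rectDiag_add_smul_single {k : Fin p} (hk : (k : ℕ) < n) (t : ℝ) :
    rectDiag n s + t • Matrix.single (⟨k, hk⟩ : Fin n) k (1 : ℝ) =
      rectDiag n (Function.update s k (s k + t)) := by
  ext a l
  simp only [rectDiag, Matrix.add_apply, Matrix.smul_apply, Matrix.of_apply, Matrix.single_apply,
    smul_eq_mul, Function.update_apply]
  by_cases hl : l = k
  · subst hl
    by_cases ha : (a : ℕ) = l
    · have : (⟨l, hk⟩ : Fin n) = a := Fin.ext ha.symm
      simp [ha, this]
    · have : (⟨l, hk⟩ : Fin n) ≠ a := fun h => ha (by rw [← h])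
      simp [ha, this]
  · have : ¬ k = l := fun h => hl h.symm
    simp [hl, this]

/-- Moving one singular value moves one eigenvalue: the derivatives of `h` in a diagonal
direction. -/
theorem derivatives_rectDiag_diag
    (hspec : ∀ X, IsSpectralDecomposition (Xᵀ * X) (V X) (lam X)) (hH : ∀ X, h X = H (lam X))
    (hg : IsGenericSpectrum n fun k => s k ^ 2)
    (hd : ContDiffAt ℝ 2 h (rectDiag n s)) (hHd : ContDiffAt ℝ 2 H fun k => s k ^ 2)
    {k : Fin p} (hk : (k : ℕ) < n) :
    fderiv ℝ h (rectDiag n s) (Matrix.single (⟨k, hk⟩ : Fin n) k 1) =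
        2 * s k * partialDeriv H k (fun k => s k ^ 2) ∧
      fderiv ℝ (fderiv ℝ h) (rectDiag n s) (Matrix.single (⟨k, hk⟩ : Fin n) k 1)
          (Matrix.single (⟨k, hk⟩ : Fin n) k 1) =
        2 * partialDeriv H k (fun k => s k ^ 2) +
          4 * s k ^ 2 * partialDeriv (partialDeriv H k) k (fun k => s k ^ 2) := by
  have hpd : partialDeriv H k =ᶠ[𝓝 fun k => s k ^ 2] fun y => fderiv ℝ H y (Pi.single k 1) := by
    filter_upwards [eventually_differentiableAt hHd] with y hy
    exact hy.lineDeriv_eq_fderiv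
  have h1 : partialDeriv H k (fun k => s k ^ 2) =
      fderiv ℝ H (fun k => s k ^ 2) (Pi.single k 1) := hpd.self_of_nhds
  have h2 : partialDeriv (partialDeriv H k) k (fun k => s k ^ 2) =
      fderiv ℝ (fderiv ℝ H) (fun k => s k ^ 2) (Pi.single k 1) (Pi.single k 1) := by
    have h3 := (hasFDerivAt_fderiv_apply hHd (Pi.single k 1)).congr_of_eventuallyEq hpd
    exact (h3.hasLineDerivAt (Pi.single k 1)).lineDeriv
  have hupd : ∀ t : ℝ, (fun l => Function.update s k (s k + t) l ^ 2) =
      (fun l => s l ^ 2) + (2 * s k * t + t ^ 2) • Pi.single k (1 : ℝ) := fun t => by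
    funext l
    by_cases hl : l = k
    · subst hl
      simp
      ring
    · simp [hl]
  have hgen : ∀ᶠ t : ℝ in 𝓝 0,
      IsGenericSpectrum n fun l => Function.update s k (s k + t) l ^ 2 := by
    refine hg.eventually (ν := fun l t => Function.update s k (s k + t) l ^ 2) (fun l => ?_)
      fun t l hl => ?_
    · have hc : Continuous fun t : ℝ => Function.update s k (s k + t) l ^ 2 := by
        by_cases hl : l = k
        · subst hl
          simp only [Function.update_self]
          fun_prop
        · simp only [Function.update_of_ne hl]
          fun_prop
      have := hc.tendsto 0
      simpa using this
    · have hlk : l ≠ k := fun h => by rw [h] at hl; omega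
      rw [Function.update_of_ne hlk]
      exact hg.zero l hl
  have heq : ∀ᶠ t : ℝ in 𝓝 0,
      h (rectDiag n s + t • Matrix.single (⟨k, hk⟩ : Fin n) k (1 : ℝ)) =
        H ((fun l => s l ^ 2) + (2 * s k * t + t ^ 2) • Pi.single k (1 : ℝ)) := by
    filter_upwards [hgen] with t ht
    rw [rectDiag_add_smul_single, hH, spectrum_rectDiag hspec ht, hupd]
  have key := fderiv_line_eq (q := fun t => 2 * s k * t + t ^ 2)
    (q' := fun t => 2 * s k + 2 * t) (q'' := 2) hd hHd (by simp)
    (fun t => by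
      have := ((hasDerivAt_id t).const_mul (2 * s k)).fun_add (hasDerivAt_pow 2 t)
      exact this.congr_deriv (by simp))
    (by simpa using ((hasDerivAt_id (0 : ℝ)).const_mul 2).const_add (2 * s k)) heq
  rw [h1, h2]
  exact ⟨key.1.trans (by ring), key.2.trans (by ring)⟩

end Diagonal

/-! ### The Hessian in off-diagonal directions -/

section OffDiagonal

theorem single_mul_rectDiag (s : Fin p → ℝ) (a b : Fin n) :
    Matrix.single a b (1 : ℝ) * rectDiag n s =
      if hb : (b : ℕ) < p then s ⟨b, hb⟩ • Matrix.single a ⟨b, hb⟩ (1 : ℝ) else 0 := by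
  ext c k
  have h1 : (Matrix.single a b (1 : ℝ) * rectDiag n s) c k =
      if a = c then rectDiag n s b k else 0 := by
    by_cases hac : a = c
    · subst hac; simp
    · rw [if_neg hac, Matrix.single_mul_apply_of_ne _ _ _ _ _ (Ne.symm hac)]
  rw [h1]
  simp only [rectDiag, Matrix.of_apply]
  split_ifs with hac hbk hb hb
  · subst hac
    have : (⟨b, hb⟩ : Fin p) = k := Fin.ext hbk
    simp [this]
  · exact absurd (hbk ▸ k.2) hb
  · have : (⟨b, hb⟩ : Fin p) ≠ k := fun h => hbk (by rw [← h])
    simp [this]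
  · simp
  · simp [hac]
  · simp

theorem rectDiag_mul_single (s : Fin p → ℝ) (l k : Fin p) :
    rectDiag n s * Matrix.single l k (1 : ℝ) =
      if hl : (l : ℕ) < n then s l • Matrix.single (⟨l, hl⟩ : Fin n) k (1 : ℝ) else 0 := by
  ext a j
  have h1 : (rectDiag n s * Matrix.single l k (1 : ℝ)) a j =
      if k = j then rectDiag n s a l else 0 := by
    by_cases hkj : k = j
    · subst hkj; simp
    · rw [if_neg hkj, Matrix.mul_single_apply_of_ne _ _ _ _ _ (Ne.symm hkj)]
  rw [h1]
  simp only [rectDiag, Matrix.of_apply]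
  split_ifs with hkj hal hl hl
  · subst hkj
    have : (⟨l, hl⟩ : Fin n) = a := Fin.ext hal.symm
    simp [this]
  · exact absurd (hal ▸ a.2) hl
  · have : (⟨l, hl⟩ : Fin n) ≠ a := fun h => hal (by rw [← h])
    simp [this]
  · simp
  · simp [hkj]
  · simp

variable {V : Matrix (Fin n) (Fin p) ℝ → Matrix (Fin p) (Fin p) ℝ}
  {lam : Matrix (Fin n) (Fin p) ℝ → Fin p → ℝ}
  {h : Matrix (Fin n) (Fin p) ℝ → ℝ} {H : (Fin p → ℝ) → ℝ} {s : Fin p → ℝ}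

/-- Infinitesimal rotations give the second derivative of `h` in an off-diagonal direction `(a, k)`
at a diagonal matrix. Rotations on the left exist when `k < n`, on the right when `a < p`; when one
of them is missing, the singular value that would multiply it vanishes. -/
theorem hessian_rectDiag_offDiag (hinv : OrthogonallyInvariant h)
    (hspec : ∀ X, IsSpectralDecomposition (Xᵀ * X) (V X) (lam X)) (hH : ∀ X, h X = H (lam X))
    (hg : IsGenericSpectrum n fun k => s k ^ 2)
    (hd : ContDiffAt ℝ 2 h (rectDiag n s)) (hHd : ContDiffAt ℝ 2 H fun k => s k ^ 2)
    {a : Fin n} {k : Fin p} (hak : (a : ℕ) ≠ k) :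
    fderiv ℝ (fderiv ℝ h) (rectDiag n s) (Matrix.single a k 1) (Matrix.single a k 1) =
      2 * partialDeriv H k (fun k => s k ^ 2) +
        2 * (if ha : (a : ℕ) < p then s ⟨a, ha⟩ ^ 2 / (s k ^ 2 - s ⟨a, ha⟩ ^ 2) *
          (partialDeriv H k (fun k => s k ^ 2) -
            partialDeriv H ⟨a, ha⟩ (fun k => s k ^ 2)) else 0) := by
  have hdiag := fun (l : Fin p) (hl : (l : ℕ) < n) =>
    (derivatives_rectDiag_diag hspec hH hg hd hHd hl).1
  set φ : Matrix (Fin n) (Fin p) ℝ → ℝ := fun A =>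
    fderiv ℝ (fderiv ℝ h) (rectDiag n s) (Matrix.single a k 1) A
  set δ : Matrix (Fin n) (Fin p) ℝ → ℝ := fun A => fderiv ℝ h (rectDiag n s) A
  have φsub : ∀ A B, φ (A - B) = φ A - φ B := fun A B => map_sub _ A B
  have φsmul : ∀ (c : ℝ) A, φ (c • A) = c * φ A := fun c A => map_smul _ c A
  have δneg : ∀ A, δ (-A) = -δ A := fun A => map_neg _ A
  change φ (Matrix.single a k 1) = _
  set E : Matrix (Fin n) (Fin p) ℝ := Matrix.single a k 1 with hE
  have hleft : ∀ hk : (k : ℕ) < n, φ (planeSkew a ⟨k, hk⟩ * rectDiag n s) =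
      2 * s k * partialDeriv H k (fun k => s k ^ 2) := fun hk => by
    have hne : a ≠ ⟨k, hk⟩ := fun h => hak (by rw [h])
    have h1 : planeSkew a ⟨k, hk⟩ * E = -Matrix.single (⟨k, hk⟩ : Fin n) k (1 : ℝ) := by
      simp [planeSkew, hE, Matrix.sub_mul, hne.symm]
    have h2 : φ (planeSkew a ⟨k, hk⟩ * rectDiag n s) = -δ (planeSkew a ⟨k, hk⟩ * E) :=
      hessian_planeSkew_mul hinv hne hd E
    rw [h2, h1, δneg, neg_neg]
    exact hdiag k hk
  have hright : ∀ ha : (a : ℕ) < p, φ (rectDiag n s * planeSkew ⟨a, ha⟩ k) =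
      2 * s ⟨a, ha⟩ * partialDeriv H ⟨a, ha⟩ (fun k => s k ^ 2) := fun ha => by
    have hne : (⟨a, ha⟩ : Fin p) ≠ k := fun h => hak (by rw [← h])
    have h1 : E * planeSkew ⟨a, ha⟩ k = -Matrix.single a (⟨a, ha⟩ : Fin p) (1 : ℝ) := by
      simp [planeSkew, hE, Matrix.mul_sub, hne.symm]
    have h2 : φ (rectDiag n s * planeSkew ⟨a, ha⟩ k) = -δ (E * planeSkew ⟨a, ha⟩ k) :=
      hessian_mul_planeSkew hinv hne hd E
    rw [h2, h1, δneg, neg_neg]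
    exact hdiag ⟨a, ha⟩ a.2
  have hsz : ∀ l : Fin p, n ≤ (l : ℕ) → s l = 0 := fun l hl =>
    pow_eq_zero_iff two_ne_zero |>.1 (hg.zero l hl)
  have hsne : ∀ l : Fin p, (l : ℕ) < n → s l ≠ 0 := fun l hl =>
    fun h => (hg.pos l hl).ne' (by simp [h])
  have hJ : ∀ hk : (k : ℕ) < n, planeSkew a ⟨k, hk⟩ * rectDiag n s = s k • E -
      if ha : (a : ℕ) < p then s ⟨a, ha⟩ • Matrix.single (⟨k, hk⟩ : Fin n) ⟨a, ha⟩ (1 : ℝ)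
        else 0 := fun hk => by
    rw [planeSkew, Matrix.sub_mul, single_mul_rectDiag, single_mul_rectDiag, dif_pos k.2]
  have hK : ∀ ha : (a : ℕ) < p, rectDiag n s * planeSkew ⟨a, ha⟩ k = s ⟨a, ha⟩ • E -
      if hk : (k : ℕ) < n then s k • Matrix.single (⟨k, hk⟩ : Fin n) ⟨a, ha⟩ (1 : ℝ)
        else 0 := fun ha => by
    rw [planeSkew, Matrix.mul_sub, rectDiag_mul_single, rectDiag_mul_single, dif_pos a.2]
  by_cases hk : (k : ℕ) < n
  · by_cases ha : (a : ℕ) < p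
    · have hne : k ≠ (⟨a, ha⟩ : Fin p) := fun h => hak (by rw [h])
      have hlne : s k ^ 2 - s ⟨a, ha⟩ ^ 2 ≠ 0 := sub_ne_zero.2 (hg.ne hk hne)
      have hcomb : s k • (planeSkew a ⟨k, hk⟩ * rectDiag n s) -
          s ⟨a, ha⟩ • (rectDiag n s * planeSkew ⟨a, ha⟩ k) =
            (s k ^ 2 - s ⟨a, ha⟩ ^ 2) • E := by
        rw [hJ, hK, dif_pos ha, dif_pos hk]
        module
      have h1 := φsub (s k • (planeSkew a ⟨k, hk⟩ * rectDiag n s))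
        (s ⟨a, ha⟩ • (rectDiag n s * planeSkew ⟨a, ha⟩ k))
      rw [hcomb, φsmul, φsmul, φsmul, hleft hk, hright ha] at h1
      rw [dif_pos ha]
      field_simp
      linear_combination h1
    · have h1 := hleft hk
      rw [hJ, dif_neg ha, sub_zero, φsmul] at h1
      rw [dif_neg ha, mul_zero, add_zero]
      apply mul_left_cancel₀ (hsne k hk)
      linear_combination h1
  · have ha : (a : ℕ) < p := lt_of_lt_of_le a.2 ((not_lt.1 hk).trans k.2.le)
    have h1 := hright ha
    rw [hK, dif_neg hk, sub_zero, φsmul] at h1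
    have hsa := hsne ⟨a, ha⟩ a.2
    have h2 : φ E = 2 * partialDeriv H ⟨a, ha⟩ (fun k => s k ^ 2) := by
      apply mul_left_cancel₀ hsa
      linear_combination h1
    rw [dif_pos ha, hsz k (not_lt.1 hk), h2]
    field_simp
    ring

/-- The trace over `a` of the Hessian of `h` at a diagonal matrix, in the directions of the column
`k`, produces the part of `riskDiag` that is linear in `H`. -/
theorem sum_hessian_rectDiag (hinv : OrthogonallyInvariant h)
    (hspec : ∀ X, IsSpectralDecomposition (Xᵀ * X) (V X) (lam X)) (hH : ∀ X, h X = H (lam X))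
    (hg : IsGenericSpectrum n fun k => s k ^ 2)
    (hd : ContDiffAt ℝ 2 h (rectDiag n s)) (hHd : ContDiffAt ℝ 2 H fun k => s k ^ 2)
    (k : Fin p) :
    2 * ∑ a, fderiv ℝ (fderiv ℝ h) (rectDiag n s) (Matrix.single a k 1) (Matrix.single a k 1) +
        4 * s k ^ 2 * partialDeriv H k (fun k => s k ^ 2) ^ 2 =
      riskDiag n H (fun k => s k ^ 2) k := by
  set P : Fin p → ℝ := fun l => partialDeriv H l (fun k => s k ^ 2)
  set Q : ℝ := partialDeriv (partialDeriv H k) k (fun k => s k ^ 2) with hQ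
  -- the summand as a function of the row or column number
  let τ : ℕ → ℝ := fun m => if m = k then 2 * s k ^ 2 * Q else
    if hm : m < p then s ⟨m, hm⟩ ^ 2 / (s k ^ 2 - s ⟨m, hm⟩ ^ 2) * (P k - P ⟨m, hm⟩) else 0
  have hτp : ∀ m, p ≤ m → τ m = 0 := fun m hm => by
    have h1 : m ≠ k := fun h => by have := k.2; omega
    simp only [τ, if_neg h1, dif_neg (not_lt.2 hm)]
  have hτn : ∀ m, n ≤ m → τ m = 0 := fun m hm => by
    by_cases h1 : m = k
    · have := hg.zero k (h1 ▸ hm)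
      simp only [τ, if_pos h1, this]
      ring
    · by_cases h2 : m < p
      · have := hg.zero ⟨m, h2⟩ hm
        simp only [τ, if_neg h1, dif_pos h2, this]
        ring
      · exact hτp m (not_lt.1 h2)
  have hsum : ∑ a : Fin n, τ a = ∑ l : Fin p, τ l := by
    rw [Fin.sum_univ_eq_sum_range, Fin.sum_univ_eq_sum_range]
    have key : ∀ N, (∀ m, N ≤ m → τ m = 0) →
        ∑ m ∈ Finset.range N, τ m = ∑ m ∈ Finset.range (n + p), τ m ∨ n + p < N := fun N hN => by
      by_cases hlt : n + p < N
      · exact Or.inr hlt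
      · refine Or.inl (Finset.sum_subset (Finset.range_mono (not_lt.1 hlt)) fun m _ hm => ?_)
        exact hN m (not_lt.1 fun h => hm (Finset.mem_range.2 h))
    rw [(key n hτn).resolve_right (by omega), (key p hτp).resolve_right (by omega)]
  have hhess : ∀ a : Fin n, fderiv ℝ (fderiv ℝ h) (rectDiag n s) (Matrix.single a k 1)
      (Matrix.single a k 1) = 2 * P k + 2 * τ a := fun a => by
    by_cases hak : (a : ℕ) = k
    · have hk : (k : ℕ) < n := hak ▸ a.2
      have ha : a = ⟨k, hk⟩ := Fin.ext hak
      have h1 := (derivatives_rectDiag_diag hspec hH hg hd hHd hk).2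
      rw [ha]
      refine h1.trans ?_
      simp only [τ, if_true]
      ring
    · have h1 := hessian_rectDiag_offDiag hinv hspec hH hg hd hHd hak
      refine h1.trans ?_
      simp only [τ, if_neg hak]
      rfl
  have hsplit : ∑ l : Fin p, τ l = 2 * s k ^ 2 * Q +
      ∑ l ∈ Finset.univ.erase k, s l ^ 2 / (s k ^ 2 - s l ^ 2) * (P k - P l) := by
    rw [← Finset.add_sum_erase _ _ (Finset.mem_univ k)]
    congr 1
    · simp only [τ, if_true]
    · refine Finset.sum_congr rfl fun l hl => ?_
      have hlk : (l : ℕ) ≠ k := fun h => Finset.ne_of_mem_erase hl (Fin.ext h)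
      simp only [τ, if_neg hlk, dif_pos l.2]
  rw [Finset.sum_congr rfl fun a _ => hhess a, Finset.sum_add_distrib, ← Finset.mul_sum,
    ← Finset.mul_sum, hsum, hsplit]
  simp only [Finset.sum_const, Finset.card_univ, Fintype.card_fin, nsmul_eq_mul, riskDiag]
  rw [← hQ]
  change _ = 4 * (2 * s k ^ 2 * Q + n * P k + s k ^ 2 * P k ^ 2 +
    ∑ l ∈ Finset.univ.erase k, s l ^ 2 / (s k ^ 2 - s l ^ 2) * (P k - P l))
  ring

end OffDiagonal

/-! ### Singular value decomposition and change of basis -/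

section SingularValues

/-- A singular value decomposition with prescribed right factor: the first columns of `X V`,
normalised, extend to an orthonormal basis. -/
theorem IsSpectralDecomposition.exists_orthogonal_eq_mul_rectDiag_mul
    {X : Matrix (Fin n) (Fin p) ℝ} {V : Matrix (Fin p) (Fin p) ℝ} {lam : Fin p → ℝ}
    (hd : IsSpectralDecomposition (Xᵀ * X) V lam) (hg : IsGenericSpectrum n lam) :
    ∃ P ∈ Matrix.orthogonalGroup (Fin n) ℝ,
      X = P * rectDiag n (fun k => √(lam k)) * Vᵀ := by
  have hgram : ∀ k l, ∑ b, (X * V) b k * (X * V) b l = if k = l then lam k else 0 := fun k l => by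
    have h := congrFun (congrFun hd.gram_eq_diagonal k) l
    rwa [Matrix.mul_apply, Matrix.diagonal_apply] at h
  let v : Fin n → EuclideanSpace ℝ (Fin n) := fun a =>
    if ha : (a : ℕ) < p then
      WithLp.toLp 2 fun b => (√(lam ⟨a, ha⟩))⁻¹ * (X * V) b ⟨a, ha⟩ else 0
  have hva : ∀ (a : Fin n) (ha : (a : ℕ) < p), v a =
      WithLp.toLp 2 fun b => (√(lam ⟨a, ha⟩))⁻¹ * (X * V) b ⟨a, ha⟩ := fun a ha => dif_pos ha
  have hv : Orthonormal ℝ (({a : Fin n | (a : ℕ) < p}).domRestrict v) := by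
    rw [orthonormal_iff_ite]
    rintro ⟨a, ha⟩ ⟨c, hc⟩
    rw [Set.domRestrict_apply, Set.domRestrict_apply, hva a ha, hva c hc, PiLp.inner_apply]
    have h1 := hgram ⟨a, ha⟩ ⟨c, hc⟩
    have h2 : ∑ b, inner ℝ ((√(lam ⟨a, ha⟩))⁻¹ * (X * V) b ⟨a, ha⟩)
        ((√(lam ⟨c, hc⟩))⁻¹ * (X * V) b ⟨c, hc⟩) =
        (√(lam ⟨a, ha⟩))⁻¹ * (√(lam ⟨c, hc⟩))⁻¹ *
          ∑ b, (X * V) b ⟨a, ha⟩ * (X * V) b ⟨c, hc⟩ := by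
      rw [Finset.mul_sum]
      refine Finset.sum_congr rfl fun b _ => ?_
      rw [real_inner_eq_re_inner, RCLike.inner_apply]
      simp
      ring
    refine h2.trans ?_
    rw [h1]
    by_cases hac : a = c
    · subst hac
      have hpos := hg.pos ⟨a, ha⟩ a.2
      rw [if_pos rfl, if_pos rfl, ← mul_inv, Real.mul_self_sqrt hpos.le,
        inv_mul_cancel₀ hpos.ne']
    · have h3 : (⟨a, ha⟩ : Fin p) ≠ ⟨c, hc⟩ := fun h => hac (Fin.ext (Fin.mk.inj h))
      have h4 : (⟨a, ha⟩ : {a : Fin n | (a : ℕ) < p}) ≠ ⟨c, hc⟩ :=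
        fun h => hac (congrArg Subtype.val h)
      rw [if_neg h3, if_neg h4, mul_zero]
  obtain ⟨b, hb⟩ := hv.exists_orthonormalBasis_extension_of_card_eq (by simp)
  let P : Matrix (Fin n) (Fin n) ℝ := Matrix.of fun i a => b a i
  refine ⟨P, ?_, ?_⟩
  · rw [Matrix.mem_orthogonalGroup_iff']
    ext a c
    have h := orthonormal_iff_ite.1 b.orthonormal a c
    rw [PiLp.inner_apply] at h
    rw [Matrix.mul_apply, Matrix.one_apply, ← h]
    refine Finset.sum_congr rfl fun i _ => ?_
    simp [P, mul_comm]
  · have key : X * V = P * rectDiag n fun k => √(lam k) := by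
      ext i k
      rw [Matrix.mul_apply (M := P)]
      simp only [rectDiag, Matrix.of_apply]
      rcases lt_or_ge (k : ℕ) n with hk | hk
      · rw [Finset.sum_eq_single (⟨k, hk⟩ : Fin n)]
        · have h1 := hb ⟨k, hk⟩ k.2
          have h2 : P i ⟨k, hk⟩ = (√(lam k))⁻¹ * (X * V) i k := by
            simp only [P, Matrix.of_apply, h1]
            rw [hva ⟨k, hk⟩ k.2]
          have hpos := Real.sqrt_pos.2 (hg.pos k hk)
          rw [h2, if_pos rfl]
          field_simp
        · intro a _ ha
          have : (a : ℕ) ≠ k := fun h => ha (Fin.ext h)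
          simp [this]
        · simp
      · rw [Finset.sum_eq_zero]
        · have h1 := hgram k k
          rw [if_pos rfl, hg.zero k hk,
            Finset.sum_eq_zero_iff_of_nonneg fun _ _ => mul_self_nonneg _] at h1
          exact mul_self_eq_zero.1 (h1 i (Finset.mem_univ i))
        · intro a _
          have : (a : ℕ) ≠ k := by omega
          simp [this]
    rw [← key, Matrix.mul_assoc, hd.mul_transpose, Matrix.mul_one]

end SingularValues

section Transport

theorem isLinearMap_eq_sum_single {φ : Matrix (Fin n) (Fin p) ℝ → ℝ} (hφ : IsLinearMap ℝ φ)
    (A : Matrix (Fin n) (Fin p) ℝ) :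
    φ A = ∑ b, ∑ k, A b k * φ (Matrix.single b k 1) := by
  have h1 : A = ∑ b, ∑ k, A b k • Matrix.single b k (1 : ℝ) := by
    conv_lhs => rw [Matrix.matrix_eq_sum_single A]
    simp
  have h2 : ∀ B, φ B = IsLinearMap.mk' φ hφ B := fun _ => rfl
  conv_lhs => rw [h1]
  rw [h2]
  simp only [map_sum, map_smul, smul_eq_mul]
  rfl

theorem transpose_mul_single_mul_apply (P : Matrix (Fin n) (Fin n) ℝ)
    (V : Matrix (Fin p) (Fin p) ℝ) (a b : Fin n) (i k : Fin p) :
    (Pᵀ * Matrix.single a i (1 : ℝ) * V) b k = P a b * V i k := by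
  rw [Matrix.mul_apply, Finset.sum_eq_single i]
  · simp
  · intro l _ hl
    rw [Matrix.mul_single_apply_of_ne _ _ _ _ _ hl, zero_mul]
  · simp

/-- Summation over an orthonormal family of rows. -/
theorem sum_orthogonal_quadratic {P : Matrix (Fin n) (Fin n) ℝ}
    (hP : P ∈ Matrix.orthogonalGroup (Fin n) ℝ) (γ : Fin n → Fin n → ℝ) :
    ∑ a, ∑ b, ∑ c, P a b * P a c * γ b c = ∑ b, γ b b := by
  have h1 : ∀ b c, ∑ a, P a b * P a c = if b = c then 1 else 0 := fun b c => by
    have h := congrFun (congrFun ((Matrix.mem_orthogonalGroup_iff' _ _).1 hP) b) c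
    rwa [Matrix.mul_apply, Matrix.one_apply] at h
  rw [Finset.sum_comm]
  refine Finset.sum_congr rfl fun b _ => ?_
  rw [Finset.sum_comm]
  simp_rw [← Finset.sum_mul, h1]
  simp

end Transport

/-! ### The pointwise identity and the risk formula -/

section RiskIdentity

variable {V : Matrix (Fin n) (Fin p) ℝ → Matrix (Fin p) (Fin p) ℝ}
  {lam : Matrix (Fin n) (Fin p) ℝ → Fin p → ℝ}
  {h : Matrix (Fin n) (Fin p) ℝ → ℝ} {H : (Fin p → ℝ) → ℝ}

theorem contDiffAt_of_isGenericSpectrum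
    (hspec : ∀ X, IsSpectralDecomposition (Xᵀ * X) (V X) (lam X)) (hH : ∀ X, h X = H (lam X))
    {X : Matrix (Fin n) (Fin p) ℝ} (hg : IsGenericSpectrum n (lam X))
    (hHd : ContDiffAt ℝ 2 H (lam X)) : ContDiffAt ℝ 2 h X := by
  have : h = fun X => H (lam X) := funext hH
  rw [this]
  exact hHd.comp X (contDiffAt_spectrum hspec hg)

/-- The pointwise identity behind the risk formula: the symmetrised divergence of the gradient of
`h` plus its Gram matrix is `V D Vᵀ`. -/
theorem hessian_add_gram_eq (hinv : OrthogonallyInvariant h)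
    (hspec : ∀ X, IsSpectralDecomposition (Xᵀ * X) (V X) (lam X)) (hH : ∀ X, h X = H (lam X))
    {X : Matrix (Fin n) (Fin p) ℝ} (hg : IsGenericSpectrum n (lam X))
    (hHd : ContDiffAt ℝ 2 H (lam X)) (i j : Fin p) :
    2 * ∑ a, fderiv ℝ (fderiv ℝ h) X (Matrix.single a i 1) (Matrix.single a j 1) +
        ∑ a, matrixGrad h X a i * matrixGrad h X a j =
      (V X * Matrix.diagonal (riskDiag n H (lam X)) * (V X)ᵀ) i j := by
  obtain ⟨P, hP, hX⟩ := (hspec X).exists_orthogonal_eq_mul_rectDiag_mul hg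
  set W := V X
  set s : Fin p → ℝ := fun k => √(lam X k) with hs
  have hs2 : (fun k => s k ^ 2) = lam X := funext fun k => Real.sq_sqrt ((hspec X).nonneg k)
  have hWo : W ∈ Matrix.orthogonalGroup (Fin p) ℝ := (hspec X).orthogonal
  have hPt : Pᵀ ∈ Matrix.orthogonalGroup (Fin n) ℝ := by
    rw [Matrix.mem_orthogonalGroup_iff, Matrix.transpose_transpose]
    exact (Matrix.mem_orthogonalGroup_iff' _ _).1 hP
  have hgs : IsGenericSpectrum n fun k => s k ^ 2 := by rw [hs2]; exact hg
  have hHs : ContDiffAt ℝ 2 H fun k => s k ^ 2 := by rw [hs2]; exact hHd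
  have hspecs : lam (rectDiag n s) = fun k => s k ^ 2 := spectrum_rectDiag hspec hgs
  have hds : ContDiffAt ℝ 2 h (rectDiag n s) :=
    contDiffAt_of_isGenericSpectrum hspec hH (by rw [hspecs]; exact hgs)
      (by rw [hspecs]; exact hHs)
  have hL : Pᵀ * X * W = rectDiag n s := by
    rw [hX]
    have h1 : Pᵀ * (P * rectDiag n s * Wᵀ) * W = (Pᵀ * P) * rectDiag n s * (Wᵀ * W) := by
      simp only [Matrix.mul_assoc]
    rw [h1, (Matrix.mem_orthogonalGroup_iff' _ _).1 hP, (hspec X).transpose_mul, Matrix.one_mul,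
      Matrix.mul_one]
  have hlin := isLinearMap_mul_mul (n := n) (p := p) Pᵀ W
  have hLh : ∀ Y, h (Pᵀ * Y * W) = h Y := fun Y => hinv _ hPt _ hWo Y
  have hdX : ContDiffAt ℝ 2 h X := contDiffAt_of_isGenericSpectrum hspec hH hg hHd
  -- derivatives at `X` in terms of those at the diagonal matrix
  set D : Matrix (Fin n) (Fin p) ℝ → ℝ := fun A => fderiv ℝ h (rectDiag n s) A
  set B : Matrix (Fin n) (Fin p) ℝ → Matrix (Fin n) (Fin p) ℝ → ℝ := fun A C =>
    fderiv ℝ (fderiv ℝ h) (rectDiag n s) A C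
  have hDlin : IsLinearMap ℝ D := ⟨fun _ _ => map_add _ _ _, fun _ _ => map_smul _ _ _⟩
  have hBlin₂ : ∀ A, IsLinearMap ℝ (B A) := fun A =>
    ⟨fun _ _ => map_add _ _ _, fun _ _ => map_smul _ _ _⟩
  have hBlin₁ : ∀ C, IsLinearMap ℝ fun A => B A C := fun C =>
    ⟨fun A A' => DFunLike.congr_fun (map_add (fderiv ℝ (fderiv ℝ h) (rectDiag n s)) A A') C,
      fun c A => DFunLike.congr_fun (map_smul (fderiv ℝ (fderiv ℝ h) (rectDiag n s)) c A) C⟩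
  have hgrad : ∀ a k, matrixGrad h X a k = D (Pᵀ * Matrix.single a k (1 : ℝ) * W) := fun a k => by
    have h1 : matrixGrad h X a k = fderiv ℝ h X (Matrix.single a k 1) :=
      (hdX.differentiableAt two_ne_zero).lineDeriv_eq_fderiv
    rw [h1]
    have h2 := fderiv_apply_of_invariant hlin hLh (x := X)
      (by simp only [hL]; exact hds.differentiableAt two_ne_zero) (Matrix.single a k 1)
    simp only [hL] at h2
    exact h2
  have hhess : ∀ A C, fderiv ℝ (fderiv ℝ h) X A C = B (Pᵀ * A * W) (Pᵀ * C * W) := fun A C => by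
    have h2 := fderiv_fderiv_apply_of_invariant hlin hLh (x := X)
      (by simp only [hL]; exact hds) A C
    simp only [hL] at h2
    exact h2
  have hBoff : ∀ (b : Fin n) (k l : Fin p), k ≠ l →
      B (Matrix.single b k 1) (Matrix.single b l 1) = 0 := fun b k l hkl =>
    hessian_rectDiag_single_of_ne hinv hds b hkl
  -- the gradient at the diagonal matrix is diagonal
  have hDval : ∀ (b : Fin n) (k : Fin p), D (Matrix.single b k 1) =
      rectDiag n (fun k => 2 * s k * partialDeriv H k (lam X)) b k := fun b k => by
    simp only [rectDiag, Matrix.of_apply]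
    split_ifs with hbk
    · have hk : (k : ℕ) < n := hbk ▸ b.2
      have hb : b = ⟨k, hk⟩ := Fin.ext hbk
      have h1 := (derivatives_rectDiag_diag hspec hH hgs hds hHs hk).1
      rw [hs2] at h1
      rw [hb]
      exact h1
    · exact fderiv_rectDiag_single_of_ne hinv (hds.differentiableAt two_ne_zero) hbk
  have hgram : ∑ a, matrixGrad h X a i * matrixGrad h X a j =
      ∑ k, W i k * (4 * lam X k * partialDeriv H k (lam X) ^ 2) * W j k := by
    set Γ : Matrix (Fin n) (Fin p) ℝ :=
      rectDiag n fun k => 2 * s k * partialDeriv H k (lam X) with hΓ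
    have hG : ∀ a k, matrixGrad h X a k = (P * Γ * Wᵀ) a k := fun a k => by
      rw [hgrad, isLinearMap_eq_sum_single hDlin, Matrix.mul_apply, Finset.sum_comm]
      refine Finset.sum_congr rfl fun l _ => ?_
      rw [Matrix.mul_apply, Finset.sum_mul]
      refine Finset.sum_congr rfl fun b _ => ?_
      rw [transpose_mul_single_mul_apply, hDval, Matrix.transpose_apply]
      ring
    have h1 : ∑ a, matrixGrad h X a i * matrixGrad h X a j =
        ((P * Γ * Wᵀ)ᵀ * (P * Γ * Wᵀ)) i j := by
      rw [Matrix.mul_apply]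
      exact Finset.sum_congr rfl fun a _ => by rw [hG, hG, Matrix.transpose_apply]
    have h2 : (P * Γ * Wᵀ)ᵀ * (P * Γ * Wᵀ) = W * (Γᵀ * Γ) * Wᵀ := by
      calc _ = W * (Γᵀ * ((Pᵀ * P) * Γ)) * Wᵀ := by
            simp only [Matrix.transpose_mul, Matrix.transpose_transpose, Matrix.mul_assoc]
        _ = _ := by rw [(Matrix.mem_orthogonalGroup_iff' _ _).1 hP, Matrix.one_mul]
    have h3 : Γᵀ * Γ = Matrix.diagonal fun k => 4 * lam X k * partialDeriv H k (lam X) ^ 2 := by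
      rw [hΓ, rectDiag_transpose_mul_self]
      · congr 1
        funext k
        rw [← congrFun hs2 k]
        ring
      · intro k hk
        have : s k = 0 := by simp [hs, hg.zero k hk]
        rw [this]
        ring
    rw [h1, h2, h3, Matrix.mul_apply]
    exact Finset.sum_congr rfl fun k _ => by rw [Matrix.mul_diagonal, Matrix.transpose_apply]
  have htrace : ∑ a, fderiv ℝ (fderiv ℝ h) X (Matrix.single a i 1) (Matrix.single a j 1) =
      ∑ k, W i k * (∑ b, B (Matrix.single b k 1) (Matrix.single b k 1)) * W j k := by
    have h1 : ∀ a, fderiv ℝ (fderiv ℝ h) X (Matrix.single a i 1) (Matrix.single a j 1) =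
        ∑ b, ∑ c, P a b * P a c * ∑ k, ∑ l, W i k * W j l *
          B (Matrix.single b k 1) (Matrix.single c l 1) := fun a => by
      rw [hhess, isLinearMap_eq_sum_single (hBlin₁ _)]
      refine Finset.sum_congr rfl fun b _ => ?_
      have h2 : ∀ k, B (Matrix.single b k 1) (Pᵀ * Matrix.single a j (1 : ℝ) * W) =
          ∑ c, ∑ l, P a c * W j l * B (Matrix.single b k 1) (Matrix.single c l 1) := fun k => by
        rw [isLinearMap_eq_sum_single (hBlin₂ _)]
        simp only [transpose_mul_single_mul_apply]
      simp only [h2, transpose_mul_single_mul_apply, Finset.mul_sum]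
      rw [Finset.sum_comm]
      refine Finset.sum_congr rfl fun c _ => Finset.sum_congr rfl fun k _ =>
        Finset.sum_congr rfl fun l _ => ?_
      ring
    rw [Finset.sum_congr rfl fun a _ => h1 a, sum_orthogonal_quadratic hP, Finset.sum_comm]
    refine Finset.sum_congr rfl fun k _ => ?_
    rw [Finset.mul_sum, Finset.sum_mul]
    refine Finset.sum_congr rfl fun b _ => ?_
    rw [Finset.sum_eq_single k]
    · ring
    · intro l _ hl
      rw [hBoff b k l hl.symm, mul_zero]
    · simp
  rw [htrace, hgram, Matrix.mul_apply, Finset.mul_sum, ← Finset.sum_add_distrib]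
  refine Finset.sum_congr rfl fun k _ => ?_
  have hk : 2 * ∑ b, B (Matrix.single b k 1) (Matrix.single b k 1) +
      4 * s k ^ 2 * partialDeriv H k (fun k => s k ^ 2) ^ 2 = riskDiag n H (fun k => s k ^ 2) k :=
    sum_hessian_rectDiag hinv hspec hH hgs hds hHs k
  rw [hs2, congrFun hs2 k] at hk
  rw [Matrix.mul_diagonal, Matrix.transpose_apply, ← hk]
  ring

end RiskIdentity

end MatrixRisk

theorem theorem1 {n p : ℕ}
    (h : Matrix (Fin n) (Fin p) ℝ → ℝ) (H : (Fin p → ℝ) → ℝ)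
    (V : Matrix (Fin n) (Fin p) ℝ → Matrix (Fin p) (Fin p) ℝ)
    (lam : Matrix (Fin n) (Fin p) ℝ → Fin p → ℝ)
    (hspec : ∀ X, MatrixRisk.IsSpectralDecomposition (Xᵀ * X) (V X) (lam X))
    (hinv : MatrixRisk.OrthogonallyInvariant h)
    (hH : ∀ X, h X = H (lam X))
    (hsmooth : ∀ᵐ X ∂(MatrixRisk.lebesgueMatrix n p), ContDiffAt ℝ 2 H (lam X))
    (hweak : ∀ a i, MatrixRisk.WeaklyDifferentiable fun X => MatrixRisk.matrixGrad h X a i)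
    (M : Matrix (Fin n) (Fin p) ℝ)
    (hL2 : ∀ a i, MemLp (fun X => MatrixRisk.matrixGrad h X a i) 2
      (MatrixRisk.gaussianMatrix M))
    (hD : MatrixRisk.EntrywiseIntegrable
      (fun X => V X * Matrix.diagonal (MatrixRisk.riskDiag n H (lam X)) * (V X)ᵀ)
      (MatrixRisk.gaussianMatrix M)) :
    MatrixRisk.EntrywiseIntegrable
        (fun X => MatrixRisk.matrixLoss M (MatrixRisk.pseudoBayes h X))
        (MatrixRisk.gaussianMatrix M) ∧
      MatrixRisk.matrixExpectation (MatrixRisk.gaussianMatrix M)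
          (fun X => MatrixRisk.matrixLoss M (MatrixRisk.pseudoBayes h X)) =
        (n : ℝ) • (1 : Matrix (Fin p) (Fin p) ℝ) +
          MatrixRisk.matrixExpectation (MatrixRisk.gaussianMatrix M)
            (fun X => V X * Matrix.diagonal (MatrixRisk.riskDiag n H (lam X)) * (V X)ᵀ) := by
  open MatrixRisk in
  set γ := gaussianMatrix M with hγ
  -- almost everywhere the spectrum is generic and `h` is twice differentiable
  have hgen : ∀ᵐ X ∂(lebesgueMatrix n p), IsGenericSpectrum n (lam X) := by
    filter_upwards [ae_gramHankel_ne_zero n p] with X hX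
    exact (gramHankel_ne_zero_iff (hspec X)).1 hX
  have hcd : ∀ᵐ X ∂(lebesgueMatrix n p), ContDiffAt ℝ 2 h X := by
    filter_upwards [hgen, hsmooth] with X h1 h2
    exact contDiffAt_of_isGenericSpectrum hspec hH h1 h2
  have hopen : IsOpen {X | ContDiffAt ℝ 2 h X} :=
    isOpen_iff_mem_nhds.2 fun X (hX : ContDiffAt ℝ 2 h X) => hX.eventually (by simp)
  -- the weak derivatives of the gradient are the entries of the Hessian
  choose w hw using fun (a : Fin n) (j : Fin p) (i : Fin p) => (hweak a j).2 a i
  have hwae : ∀ a j i, ∀ᵐ X ∂(lebesgueMatrix n p),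
      w a j i X = fderiv ℝ (fderiv ℝ h) X (Matrix.single a i 1) (Matrix.single a j 1) := by
    intro a j i
    have hgr : ∀ X, ContDiffAt ℝ 2 h X → (fun X => matrixGrad h X a j) =ᶠ[nhds X]
        fun X => fderiv ℝ h X (Matrix.single a j 1) := fun X hX => by
      filter_upwards [eventually_differentiableAt hX] with Y hY
      exact hY.lineDeriv_eq_fderiv
    have h1 := ae_eq_fderiv_of_weak (μ := lebesgueMatrix n p) (O := {X | ContDiffAt ℝ 2 h X})
      (u := fun X => matrixGrad h X a j) (w := w a j i) (v := Matrix.single a i 1) hopen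
      (fun X (hX : ContDiffAt ℝ 2 h X) => (((hX.fderiv_right (m := 1) (by norm_num)).clm_apply
        contDiffAt_const).congr_of_eventuallyEq (hgr X hX)))
      (hw a j i).1 (fun φ hφ hφc => (hw a j i).2 φ ⟨hφ, hφc⟩)
    filter_upwards [h1, hcd] with X hX1 hX2
    have h3 := (hasFDerivAt_fderiv_apply hX2 (Matrix.single a j 1)).congr_of_eventuallyEq
      (hgr X hX2)
    exact (hX1 hX2).trans (DFunLike.congr_fun h3.fderiv (Matrix.single a i 1))
  have hac : γ ≪ lebesgueMatrix n p := gaussianMatrix_absolutelyContinuous M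
  have hsum : ∀ i j, ∀ᵐ X ∂γ, 2 * ∑ a, w a j i X +
      ∑ a, matrixGrad h X a i * matrixGrad h X a j =
      (V X * Matrix.diagonal (riskDiag n H (lam X)) * (V X)ᵀ) i j := by
    intro i j
    refine hac.ae_le ?_
    filter_upwards [hgen, hsmooth, ae_all_iff.2 fun a => hwae a j i] with X h1 h2 h3
    rw [← hessian_add_gram_eq hinv hspec hH h1 h2 i j]
    simp only [h3]
  have hgg : ∀ a i j, Integrable (fun X => matrixGrad h X a i * matrixGrad h X a j) γ :=
    fun a i j => (hL2 a i).integrable_mul (hL2 a j)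
  have hxg : ∀ a i j, Integrable (fun X => (X a i - M a i) * matrixGrad h X a j) γ :=
    fun a i j => (memLp_entry_sub M a i).integrable_mul (hL2 a j)
  have hxx : ∀ a i j, Integrable
      (fun X : Matrix (Fin n) (Fin p) ℝ => (X a i - M a i) * (X a j - M a j)) γ :=
    fun a i j => (memLp_entry_sub M a i).integrable_mul (memLp_entry_sub M a j)
  have hS : ∀ i j, Integrable (fun X => ∑ a, w a j i X) γ := fun i j => by
    have h1 := ((hD i j).sub (integrable_finsetSum Finset.univ fun a _ => hgg a i j)).const_mul 2⁻¹
    refine h1.congr ?_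
    filter_upwards [hsum i j] with X hX
    simp only [Pi.sub_apply, ← hX]
    ring
  have hstein : ∀ i j, ∫ X, ∑ a, (X a i - M a i) * matrixGrad h X a j ∂γ =
      ∫ X, ∑ a, w a j i X ∂γ := fun i j =>
    integral_gaussianMatrix_stein M i (fun a X => matrixGrad h X a j) (fun a => w a j i)
      (fun a => hw a j i) (fun a => hL2 a j) (hS i j)
  have hloss : ∀ i j X, matrixLoss M (pseudoBayes h X) i j =
      ∑ a, (X a i - M a i) * (X a j - M a j) + ∑ a, (X a i - M a i) * matrixGrad h X a j +
        (∑ a, (X a j - M a j) * matrixGrad h X a i +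
          ∑ a, matrixGrad h X a i * matrixGrad h X a j) := fun i j X => by
    rw [matrixLoss, Matrix.mul_apply, ← Finset.sum_add_distrib, ← Finset.sum_add_distrib,
      ← Finset.sum_add_distrib]
    refine Finset.sum_congr rfl fun a _ => ?_
    simp only [pseudoBayes, Matrix.transpose_apply, Matrix.sub_apply, Matrix.add_apply]
    ring
  have ixx : ∀ i j, Integrable (fun X : Matrix (Fin n) (Fin p) ℝ =>
      ∑ a, (X a i - M a i) * (X a j - M a j)) γ :=
    fun i j => integrable_finsetSum _ fun a _ => hxx a i j
  have ixg : ∀ i j, Integrable (fun X => ∑ a, (X a i - M a i) * matrixGrad h X a j) γ :=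
    fun i j => integrable_finsetSum _ fun a _ => hxg a i j
  have igg : ∀ i j, Integrable (fun X => ∑ a, matrixGrad h X a i * matrixGrad h X a j) γ :=
    fun i j => integrable_finsetSum _ fun a _ => hgg a i j
  refine ⟨fun i j => ?_, ?_⟩
  · simp only [hloss]
    exact ((ixx i j).add (ixg i j)).add ((ixg j i).add (igg i j))
  · ext i j
    simp only [matrixExpectation, Matrix.of_apply, Matrix.add_apply, Matrix.smul_apply,
      smul_eq_mul, hloss]
    -- the Hessian is symmetric: both cross terms have the same divergence
    have hsymm : ∫ X, ∑ a, w a i j X ∂γ = ∫ X, ∑ a, w a j i X ∂γ := by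
      refine integral_congr_ae (hac.ae_le ?_)
      filter_upwards [hcd, ae_all_iff.2 fun a => hwae a j i, ae_all_iff.2 fun a => hwae a i j]
        with X h1 h2 h3
      refine Finset.sum_congr rfl fun a _ => ?_
      rw [h2, h3]
      exact (h1.isSymmSndFDerivAt (by simp)).eq _ _
    have hcov : ∫ X, ∑ a, (X a i - M a i) * (X a j - M a j) ∂γ =
        n * (1 : Matrix (Fin p) (Fin p) ℝ) i j := by
      rw [integral_finsetSum _ fun a _ => hxx a i j]
      simp only [hγ, integral_entry_sub_mul, Matrix.one_apply, Finset.sum_const, Finset.card_univ,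
        Fintype.card_fin, nsmul_eq_mul]
    have hVD : ∫ X, (V X * Matrix.diagonal (riskDiag n H (lam X)) * (V X)ᵀ) i j ∂γ =
        2 * ∫ X, ∑ a, w a j i X ∂γ +
          ∫ X, ∑ a, matrixGrad h X a i * matrixGrad h X a j ∂γ := by
      rw [← integral_congr_ae (hsum i j), integral_add ((hS i j).const_mul 2) (igg i j),
        integral_const_mul]
    have i1 : Integrable (fun X => ∑ a, (X a i - M a i) * (X a j - M a j) +
        ∑ a, (X a i - M a i) * matrixGrad h X a j) γ := (ixx i j).add (ixg i j)
    have i2 : Integrable (fun X => ∑ a, (X a j - M a j) * matrixGrad h X a i +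
        ∑ a, matrixGrad h X a i * matrixGrad h X a j) γ := (ixg j i).add (igg i j)
    rw [integral_add i1 i2,
      integral_add (ixx i j) (ixg i j), integral_add (ixg j i) (igg i j), hstein i j, hstein j i,
      hsymm, hcov, hVD]
    ring
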